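/- Let $\mathbb{K}$ be an algebraically closed field of characteristic zero. For a finite-dimensional local $\mathbb{K}$-algebra $(\mathcal{A},\mathfrak{n})$ let $H_{\mathcal{A}}(i)=\dim_{\mathbb{K}}\mathfrak{n}^i/\mathfrak{n}^{i+1}$ be its Hilbert function, and let its socle degree be the largest $s$ with $\mathfrak{n}^s\neq 0$. Let $R=\mathbb{K}[\alpha_1,\dots,\alpha_n]\subset\hat R=\mathbb{K}[[\alpha_1,\dots,\alpha_n]]$, let $\pi_i:\hat R\to\mathbb{K}[[\alpha_i]]$ be the projection with $\pi_i(\alpha_i)=\alpha_i$ and $\pi_i(\alpha_j)=0$ for $j\ne i$, and let $\mathfrak{p}_i=\ker\pi_i$. For an ideal $I\subset\hat R$ of finite colength, a ray decomposition of $I$ with respect to $\alpha_i$ is an equality $I=J+(\alpha_i^\nu-q)\hat R$ with an ideal $J\subset I\cap\mathfrak{p}_i$, $q\in R\cap\mathfrak{p}_i$ and $\nu\in\mathbb{N}$. For $\nu\geq 1$ its upper ray family is $$\mathbb{K}[t]\to\mathcal{F}=\frac{R[t]}{(J\cap R)[t]+(\alpha_i^{\nu}-t\alpha_i^{\nu-1}-q)R[t]},$$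 and it is called an upper ray degeneration if it is flat. **Theorem.** Let $c\ge 0$ and $s\geq\max(1,2c)$ be integers and let $\mathcal{A}$ be a finite-dimensional local $\mathbb{K}$-algebra of socle degree $s$ with Hilbert function $(1,H_1,\dots,H_c,1,\dots,1)$, that is, $H_{\mathcal{A}}(j)=1$ for $c<j\le s$. Put $n=H_{\mathcal{A}}(1)$, and assume that the Hilbert function is not $(1,n,1)$ with $n\ge 2$. Then there are an ideal $I\subset\hat R=\mathbb{K}[[\alpha_1,\dots,\alpha_n]]$ with $\mathcal{A}\cong\hat R/I$, an index $i$, and a ray decomposition $I=J+(\alpha_i^\nu-q)\hat R$ with $J=I\cap\mathfrak{p}_i$, $\nu\ge 1$ and $\pi_i(I)=(\alpha_i^\nu)$, whose upper ray family $\mathcal{F}$ is flat and finite over $\mathbb{K}[t]$ and satisfies: * the fibre $\mathcal{F}/t\mathcal{F}$ is isomorphic to $\mathcal{A}$; * for every $\lambda\in\mathbb{K}\setminus\{0\}$ there is an isomorphism of $\mathbb{K}$-algebras $\mathcal{F}/(t-\lambda)\mathcal{F}\cong\mathbb{K}\times\mathcal{B}_\lambda$, where $\mathcal{B}_\lambda$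 is a finite-dimensional local $\mathbb{K}$-algebra of socle degree $s-1$ with $H_{\mathcal{B}_\lambda}(j)=H_{\mathcal{A}}(j)$ for all $j\le s-1$ (the same Hilbert function with one final $1$ less). Under this isomorphism the point $\operatorname{Spec}\mathbb{K}$ is the point with $\alpha_i=\lambda$ and $\alpha_j=0$ for $j\neq i$, and the images of all $\alpha_j$ in $\mathcal{B}_\lambda$ lie in its maximal ideal (so $\operatorname{Spec}\mathcal{B}_\lambda$ is supported at the origin). In particular, $\operatorname{Spec}\mathcal{A}$ is a flat limit of disjoint unions of a point and the spectrum of a local algebra with the Hilbert function shortened by one $1$. -/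

import Mathlib

universe u v

noncomputable section

namespace RayDegeneration

open IsLocalRing

/-- The Hilbert function `i ↦ dim_K 𝔫^i / 𝔫^(i+1)` of a local `K`-algebra `(A, 𝔫)`.
(It is used only for algebras that are finite-dimensional over `K`.) -/
def hilbertFunction (K : Type u) (A : Type v) [Field K] [CommRing A] [IsLocalRing A]
    [Algebra K A] (i : ℕ) : ℕ :=
  Module.finrank K
    (↥(maximalIdeal A ^ i) ⧸ (maximalIdeal A ^ (i + 1)).submoduleOf (maximalIdeal A ^ i))

/-- `s` is the socle degree of the local ring `(A, 𝔫)`: the largest integer with `𝔫^s ≠ 0`. -/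
def IsSocleDegree (A : Type v) [CommRing A] [IsLocalRing A] (s : ℕ) : Prop :=
  IsGreatest {k : ℕ | maximalIdeal A ^ k ≠ ⊥} s

section Ray

variable {K : Type u} [Field K] {n : ℕ}

/-- The projection `π_i : K⟦α_1, …, α_n⟧ → K⟦α_i⟧` with `π_i(α_j) = 0` for `j ≠ i` and
`π_i(α_i) = α_i`. -/
def rayProj (K : Type u) [Field K] {n : ℕ} (i : Fin n) :
    MvPowerSeries (Fin n) K →ₐ[K] PowerSeries K :=
  MvPowerSeries.killCompl ⟨fun _ : Unit => i, Function.injective_of_subsingleton _⟩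

/-- The kernel `𝔭_i` of `π_i`. -/
def rayIdeal (K : Type u) [Field K] {n : ℕ} (i : Fin n) : Ideal (MvPowerSeries (Fin n) K) :=
  RingHom.ker (rayProj K i)

/-- `ν` is the `i`-th ray order of `I`: `π_i(I) = (α_i^ν)`. -/
def IsRayOrder (I : Ideal (MvPowerSeries (Fin n) K)) (i : Fin n) (ν : ℕ) : Prop :=
  I.map (rayProj K i) = Ideal.span {(PowerSeries.X : PowerSeries K) ^ ν}

/-- A ray decomposition `I = J + (α_i^ν - q)` of `I` with respect to `α_i`, where
`J ⊆ I ∩ 𝔭_i` and where `q ∈ 𝔭_i` is a polynomial. -/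
structure RayDecomposition (I : Ideal (MvPowerSeries (Fin n) K)) (i : Fin n) where
  J : Ideal (MvPowerSeries (Fin n) K)
  q : MvPolynomial (Fin n) K
  ν : ℕ
  J_le : J ≤ I ⊓ rayIdeal K i
  q_mem : (q : MvPowerSeries (Fin n) K) ∈ rayIdeal K i
  eq_sup : I = J ⊔ Ideal.span {MvPowerSeries.X i ^ ν - (q : MvPowerSeries (Fin n) K)}

namespace RayDecomposition

variable {I : Ideal (MvPowerSeries (Fin n) K)} {i : Fin n}

/-- The contraction `J_R = J ∩ R` to the polynomial ring `R = K[α_1, …, α_n]`. -/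
def polyJ (D : RayDecomposition I i) : Ideal (MvPolynomial (Fin n) K) :=
  D.J.comap MvPolynomial.coeToMvPowerSeries.ringHom

/-- The ideal `J_R[t] + (α_i^ν - t α_i^(ν-1) - q)` of `R[t]`, where `R[t]` is realised as
`K[t][α_1, …, α_n]`. It is meant for `ν ≥ 1`, i.e. for proper ideals `I`. -/
def upperRayIdeal (D : RayDecomposition I i) : Ideal (MvPolynomial (Fin n) (Polynomial K)) :=
  D.polyJ.map (MvPolynomial.map (Polynomial.C : K →+* Polynomial K)) ⊔
    Ideal.span {MvPolynomial.X i ^ D.ν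
      - MvPolynomial.C Polynomial.X * MvPolynomial.X i ^ (D.ν - 1)
      - MvPolynomial.map Polynomial.C D.q}

/-- The upper ray family `K[t] → R[t] / (J_R[t] + (α_i^ν - t α_i^(ν-1) - q))`. -/
abbrev UpperRayFamily (D : RayDecomposition I i) : Type u :=
  MvPolynomial (Fin n) (Polynomial K) ⧸ D.upperRayIdeal

/-- The upper ray family is an upper ray degeneration when it is flat over `K[t]`. -/
def IsUpperRayDegeneration (D : RayDecomposition I i) : Prop :=
  Module.Flat (Polynomial K) D.UpperRayFamily

end RayDecomposition

end Ray

/-- The fibre `F / (t - a) F` of a family `K[t] → F` over the point `t = a`. -/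
abbrev Fibre {K : Type u} [Field K] (F : Type v) [CommRing F] [Algebra (Polynomial K) F]
    (a : K) : Type v :=
  F ⧸ Ideal.span {algebraMap (Polynomial K) F (Polynomial.X - Polynomial.C a)}

/-- The class of the coordinate `α_j` in the fibre of the upper ray family over `t = a`. -/
def fibreCoord {K : Type u} [Field K] {n : ℕ} {I : Ideal (MvPowerSeries (Fin n) K)} {i : Fin n}
    (D : RayDecomposition I i) (a : K) (j : Fin n) : Fibre D.UpperRayFamily a :=
  Ideal.Quotient.mk _ (Ideal.Quotient.mk D.upperRayIdeal (MvPolynomial.X j))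

end RayDegeneration

end

/-!
Polarization gives `x ∈ 𝔫` with `x^s ≠ 0`, since `s!` is invertible. As the Hilbert function is
`1` beyond `c`, we have `𝔫^j = (x^j)` for `j > c`; completing `x = α_i` to a system of generators
of `𝔫` and correcting the other generators by multiples of `x`, we may assume that the ideal `𝔟`
which they generate is killed by `x^c`. The ray order `ν` is the least exponent with `x^ν ∈ 𝔟`, and
`s ≥ 2c` forces `ν > c`, so that `x^(ν-1)` kills `𝔟`. Excluding `(1, n, 1)` leaves `c < s - 1` or
`𝔟 = 0`, so that `𝔫^(s-1)` kills `𝔟` as well.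

Since `R/J` embeds into `K[α_i] × A`, this means that a multiple of the ray equation
`α_i^ν - t α_i^(ν-1) - q` modulo `J[t]` depends only on the restriction of the multiplier to the
axis, where the equation becomes `α_i^(ν-1) (α_i - t)`. Hence the family has no `K[t]`-torsion.
At `t = a ≠ 0` the point `α_i = a` of the axis splits off. The residual algebra at the origin and
`A` are quotients of `R/J` by equations of ray orders `ν - 1` and `ν` which have the same multiples
modulo `𝔫^k`, up to this shift by one, so their Hilbert functions agree below degree `s`.
-/

noncomputable section

namespace RayDegeneration

open IsLocalRing MvPolynomial

section Polarization

variable {R : Type*} [CommRing R]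

lemma sum_neg_one_pow_card_mul_sum_compl_pow {ι : Type*} [Fintype ι] [DecidableEq ι] (f : ι → R) :
    ∑ T : Finset ι, (-1) ^ T.card * (∑ i ∈ Tᶜ, f i) ^ Fintype.card ι =
      (Fintype.card ι).factorial * ∏ i, f i := by
  have expand (T : Finset ι) : (∑ i ∈ Tᶜ, f i) ^ Fintype.card ι =
      ∑ g : ι → ι, if T ⊆ (Finset.univ.image g)ᶜ then ∏ j, f (g j) else 0 := by
    rw [← Finset.card_univ, ← Finset.prod_const, Finset.prod_univ_sum, ← Finset.sum_filter]
    refine Finset.sum_congr (Finset.ext fun g => ?_) fun _ _ => rfl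
    simp only [Fintype.mem_piFinset, Finset.mem_filter_univ, Finset.subset_compl_comm (s := T),
      Finset.image_subset_iff, Finset.mem_univ, true_implies]
  have sum_signs (g : ι → ι) :
      (∑ T : Finset ι, if T ⊆ (Finset.univ.image g)ᶜ then (-1 : R) ^ T.card else 0) =
        if Function.Bijective g then 1 else 0 := by
    have filter_eq : ({T | T ⊆ (Finset.univ.image g)ᶜ} : Finset (Finset ι)) =
        (Finset.univ.image g)ᶜ.powerset := by ext; simp
    have image_eq_univ : Finset.univ.image g = Finset.univ ↔ Function.Bijective g := by
      rw [← Finite.surjective_iff_bijective, Finset.eq_univ_iff_forall]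
      simp [Function.Surjective]
    have sum_int := congrArg (Int.cast (R := R))
      (Finset.sum_powerset_neg_one_pow_card (x := (Finset.univ.image g)ᶜ))
    rw [← Finset.sum_filter, filter_eq]
    simpa only [Finset.compl_eq_empty_iff, image_eq_univ, Int.cast_sum, Int.cast_pow, Int.cast_neg,
      Int.cast_one, Int.cast_ite, Int.cast_zero] using sum_int
  calc ∑ T : Finset ι, (-1) ^ T.card * (∑ i ∈ Tᶜ, f i) ^ Fintype.card ι
      = ∑ g : ι → ι, (∑ T : Finset ι, if T ⊆ (Finset.univ.image g)ᶜ then (-1 : R) ^ T.card else 0) *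
          ∏ j, f (g j) := by
        simp only [expand, Finset.mul_sum, Finset.sum_mul, mul_ite, ite_mul, mul_zero, zero_mul]
        exact Finset.sum_comm
    _ = ∑ g : ι → ι with Function.Bijective g, ∏ j, f (g j) := by
        simp only [sum_signs, ite_mul, one_mul, zero_mul, Finset.sum_filter]
    _ = ∑ σ : Equiv.Perm ι, ∏ j, f (σ j) := by
        refine (Finset.sum_bij (fun (σ : Equiv.Perm ι) _ => ⇑σ) ?_ ?_ ?_ fun _ _ => rfl).symm
        · exact fun σ _ => by simp
        · exact fun σ _ τ _ h => DFunLike.coe_injective h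
        · exact fun g hg => ⟨.ofBijective g (by simpa using hg), Finset.mem_univ _, rfl⟩
    _ = (Fintype.card ι).factorial * ∏ i, f i := by
        simp only [Equiv.prod_comp, Finset.sum_const, Finset.card_univ, Fintype.card_perm,
          nsmul_eq_mul]

lemma pow_eq_bot_of_forall_pow_eq_zero {I : Ideal R} {s : ℕ} (hs : IsUnit (s.factorial : R))
    (hI : ∀ y ∈ I, y ^ s = 0) : I ^ s = ⊥ := by
  have prod_eq_zero (f : Fin s → R) (hf : ∀ j, f j ∈ I) : ∏ j, f j = 0 := by
    refine hs.mul_left_cancel ?_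
    have polarization := sum_neg_one_pow_card_mul_sum_compl_pow f
    rw [Fintype.card_fin] at polarization
    rw [← polarization, mul_zero]
    exact Finset.sum_eq_zero fun T _ => by rw [hI _ (sum_mem fun i _ => hf i), mul_zero]
  rw [eq_bot_iff, ← Ideal.span_eq I, Ideal.span, Submodule.span_pow, Submodule.span_le]
  intro a ha
  obtain ⟨f, rfl⟩ := Set.mem_pow.mp ha
  simpa [List.prod_ofFn] using prod_eq_zero (fun j => f j) fun j => (f j).2

end Polarization

section Axis

variable {σ R : Type*} [CommRing R]

lemma sup_pow_succ (I J : Ideal R) (k : ℕ) :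
    (I ⊔ J) ^ (k + 1) = I ^ (k + 1) ⊔ J * (I ⊔ J) ^ k := by
  induction k with
  | zero => simp
  | succ k ih =>
    have mul_le : I * (J * (I ⊔ J) ^ k) ≤ J * (I ⊔ J) ^ (k + 1) := by
      rw [mul_left_comm, pow_succ']
      exact Ideal.mul_mono_right (Ideal.mul_mono_left le_sup_left)
    rw [pow_succ' (I ⊔ J) (k + 1), Ideal.sup_mul]
    nth_rewrite 1 [ih]
    rw [Ideal.mul_sup, ← pow_succ', sup_assoc, sup_eq_right.mpr mul_le]

/-- The inclusion of the polynomials in one variable as the polynomials in the `i`-th variable. -/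
def axisIncl (i : σ) : Polynomial R →ₐ[R] MvPolynomial σ R :=
  Polynomial.aeval (X i)

lemma map_axisIncl {A : Type*} [CommRing A] [Algebra R A] (i : σ)
    (φ : MvPolynomial σ R →ₐ[R] A) (p : Polynomial R) :
    φ (axisIncl i p) = Polynomial.aeval (φ (X i)) p :=
  (Polynomial.aeval_algHom_apply φ _ p).symm

lemma X_mem_idealOfVars (j : σ) : (X j : MvPolynomial σ R) ∈ idealOfVars σ R :=
  Ideal.subset_span ⟨j, rfl⟩

variable [DecidableEq σ]

/-- Restriction of polynomials to the axis of the `i`-th coordinate; in the setting of the theorem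
this is the restriction of `π_i` to polynomials. -/
def axisProj (i : σ) : MvPolynomial σ R →ₐ[R] Polynomial R :=
  aeval (Pi.single i Polynomial.X)

variable (R) in
/-- The ideal of the axis of the `i`-th coordinate. -/
def axisIdeal (i : σ) : Ideal (MvPolynomial σ R) :=
  RingHom.ker (axisProj i)

variable {i : σ}

lemma mem_axisIdeal {r : MvPolynomial σ R} : r ∈ axisIdeal R i ↔ axisProj i r = 0 :=
  Iff.rfl

@[simp]
lemma axisProj_X_self : axisProj i (X i : MvPolynomial σ R) = Polynomial.X := by
  simp [axisProj]

lemma axisProj_X_of_ne {j : σ} (h : j ≠ i) : axisProj i (X j : MvPolynomial σ R) = 0 := by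
  simp [axisProj, h]

@[simp]
lemma axisProj_axisIncl (p : Polynomial R) : axisProj i (axisIncl i p) = p := by
  rw [axisIncl, ← Polynomial.aeval_algHom_apply, axisProj_X_self, Polynomial.aeval_X_left_apply]

lemma sub_axisIncl_mem_axisIdeal (r : MvPolynomial σ R) :
    r - axisIncl i (axisProj i r) ∈ axisIdeal R i := by
  simp [mem_axisIdeal]

lemma axisIdeal_eq_span : axisIdeal R i = Ideal.span (X '' {i}ᶜ) := by
  refine le_antisymm (fun r hr => ?_) (Ideal.span_le.mpr ?_)
  · let mk := Ideal.Quotient.mkₐ R (Ideal.span (X '' {i}ᶜ) : Ideal (MvPolynomial σ R))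
    have mk_eq : mk = mk.comp ((axisIncl i).comp (axisProj i)) := by
      ext j
      obtain rfl | hj := eq_or_ne j i
      · simp [axisIncl]
      · simpa [axisProj_X_of_ne hj, mk, Ideal.Quotient.eq_zero_iff_mem] using
          Ideal.subset_span (Set.mem_image_of_mem X hj)
    have mk_r := DFunLike.congr_fun mk_eq r
    simp only [AlgHom.comp_apply, mem_axisIdeal.mp hr, map_zero] at mk_r
    exact Ideal.Quotient.eq_zero_iff_mem.mp mk_r
  · rintro _ ⟨j, hj, rfl⟩
    exact axisProj_X_of_ne hj

lemma idealOfVars_eq_sup_axisIdeal : idealOfVars σ R = Ideal.span {X i} ⊔ axisIdeal R i := by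
  rw [axisIdeal_eq_span, ← Ideal.span_union, ← Set.image_singleton, ← Set.image_union,
    Set.union_compl_self, Set.image_univ, idealOfVars]

lemma mem_idealOfVars_pow_succ_iff {k : ℕ} {r : MvPolynomial σ R} :
    r ∈ idealOfVars σ R ^ (k + 1) ↔ Polynomial.X ^ (k + 1) ∣ axisProj i r ∧
      r - axisIncl i (axisProj i r) ∈ axisIdeal R i * idealOfVars σ R ^ k := by
  have pow_eq : idealOfVars σ R ^ (k + 1) =
      Ideal.span {X i ^ (k + 1)} ⊔ axisIdeal R i * idealOfVars σ R ^ k := by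
    rw [← Ideal.span_singleton_pow, idealOfVars_eq_sup_axisIdeal (i := i), sup_pow_succ]
  constructor
  · rw [pow_eq, Ideal.mem_span_singleton_sup]
    rintro ⟨a, b, hb, rfl⟩
    have proj_b : axisProj i b = 0 := Ideal.mul_le_left (I := axisIdeal R i) hb
    have proj : axisProj i (a * X i ^ (k + 1) + b) = axisProj i a * Polynomial.X ^ (k + 1) := by
      simp [proj_b]
    refine ⟨⟨axisProj i a, by rw [proj, mul_comm]⟩, ?_⟩
    have split : a * X i ^ (k + 1) + b - axisIncl i (axisProj i a * Polynomial.X ^ (k + 1)) =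
        (a - axisIncl i (axisProj i a)) * X i ^ (k + 1) + b := by
      simp only [axisIncl, map_mul, map_pow, Polynomial.aeval_X]
      ring
    rw [proj, split]
    exact add_mem (Ideal.mul_mem_mul (sub_axisIncl_mem_axisIdeal a)
      (Ideal.pow_le_pow_right k.le_succ (Ideal.pow_mem_pow (X_mem_idealOfVars i) _))) hb
  · rintro ⟨⟨p, hp⟩, hr⟩
    rw [← sub_add_cancel r (axisIncl i (axisProj i r)), hp, map_mul, map_pow, axisIncl,
      Polynomial.aeval_X, pow_eq]
    rw [hp, map_mul, map_pow, axisIncl, Polynomial.aeval_X] at hr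
    exact add_mem (Ideal.mem_sup_right hr) (Ideal.mem_sup_left
      (Ideal.mul_mem_right _ _ (Ideal.mem_span_singleton_self _)))

lemma mem_idealOfVars_iff {r : MvPolynomial σ R} :
    r ∈ idealOfVars σ R ↔ Polynomial.X ∣ axisProj i r := by
  simpa [sub_axisIncl_mem_axisIdeal] using mem_idealOfVars_pow_succ_iff (i := i) (k := 0) (r := r)

end Axis

section RayEquation

variable {R S A : Type*} [CommRing R] [CommRing S] [CommRing A]

/- Since `φ e` is annihilated by `φ (ker π)`, the image `φ (r * e)` of a multiple of `e` depends
only on `π r`. -/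
lemma mem_inf_ker_sup_span_singleton_iff {φ : R →+* A} {π : R →+* S} {ι : S →+* R}
    (hι : ∀ p, π (ι p) = p) {e : R} (he : ∀ r, π r = 0 → φ r * φ e = 0) {m : R} :
    m ∈ RingHom.ker φ ⊓ RingHom.ker π ⊔ Ideal.span {e} ↔
      ∃ p, π m = p * π e ∧ φ m = φ (ι p) * φ e := by
  rw [sup_comm, Ideal.mem_span_singleton_sup]
  constructor
  · rintro ⟨r, b, ⟨hφb, hπb⟩, rfl⟩
    rw [SetLike.mem_coe, RingHom.mem_ker] at hφb hπb
    have map_r : φ r * φ e = φ (ι (π r)) * φ e := by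
      rw [← sub_eq_zero, ← sub_mul, ← map_sub]
      exact he _ (by rw [map_sub, hι, sub_self])
    exact ⟨π r, by simp [hπb], by simp [hφb, map_r]⟩
  · rintro ⟨p, hπ, hφ⟩
    exact ⟨ι p, m - ι p * e, ⟨by simp [hφ], by simp [hπ, hι]⟩, by ring⟩

end RayEquation

section Length

variable {K : Type*} [Field K]

lemma finrank_quotient_add_finrank_of_tower {C V : Type*} [CommRing C] [Algebra K C]
    [AddCommGroup V] [Module C V] [Module K V] [IsScalarTower K C V] [Module.Finite K V]
    (N : Submodule C V) :
    Module.finrank K (V ⧸ N) + Module.finrank K N = Module.finrank K V := by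
  rw [← (Submodule.Quotient.restrictScalarsEquiv K N).finrank_eq]
  exact Submodule.finrank_quotient_add_finrank (N.restrictScalars K)

lemma hilbertFunction_add_finrank {A : Type*} [CommRing A] [IsLocalRing A] [Algebra K A]
    [Module.Finite K A] (j : ℕ) :
    hilbertFunction K A j + Module.finrank K (A ⧸ maximalIdeal A ^ j) =
      Module.finrank K (A ⧸ maximalIdeal A ^ (j + 1)) := by
  have pow_le : maximalIdeal A ^ (j + 1) ≤ maximalIdeal A ^ j := Ideal.pow_le_pow_right j.le_succ
  have : Module.Finite K ↥(maximalIdeal A ^ j) :=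
    Module.Finite.of_injective ((maximalIdeal A ^ j).subtype.restrictScalars K)
      Subtype.val_injective
  have layer := finrank_quotient_add_finrank_of_tower (K := K)
    ((maximalIdeal A ^ (j + 1)).submoduleOf (maximalIdeal A ^ j))
  have sub_eq := ((Submodule.submoduleOfEquivOfLe pow_le).restrictScalars K).finrank_eq
  have quot := finrank_quotient_add_finrank_of_tower (K := K) (maximalIdeal A ^ j)
  have quot_succ := finrank_quotient_add_finrank_of_tower (K := K) (maximalIdeal A ^ (j + 1))
  unfold hilbertFunction
  omega

variable {R : Type*} [CommRing R] [Algebra K R]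

lemma finrank_quotient_maximalIdeal_pow {A : Type*} [CommRing A] [IsLocalRing A] [Algebra K A]
    {χ : R →ₐ[K] A} (hχ : Function.Surjective χ) {M : Ideal R} (hM : M.map χ = maximalIdeal A)
    (k : ℕ) :
    Module.finrank K (A ⧸ maximalIdeal A ^ k) =
      Module.finrank K (R ⧸ RingHom.ker χ ⊔ M ^ k) := by
  let ψ : R →ₐ[K] A ⧸ maximalIdeal A ^ k := (Ideal.Quotient.mkₐ K _).comp χ
  have hψ : Function.Surjective ψ := (Ideal.Quotient.mkₐ_surjective K _).comp hχ
  have ker_ψ : RingHom.ker ψ = RingHom.ker χ ⊔ M ^ k := by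
    have : RingHom.ker ψ = (maximalIdeal A ^ k).comap χ := by
      ext r
      simp [ψ, RingHom.mem_ker, Ideal.Quotient.eq_zero_iff_mem]
    rw [this, ← hM, ← Ideal.map_pow, Ideal.comap_map_of_surjective _ hχ, sup_comm]
    rfl
  rw [← ker_ψ]
  exact (Ideal.quotientKerAlgEquivOfSurjective hψ).toLinearEquiv.finrank_eq.symm

lemma finrank_quotient_span_singleton_eq [Module.Finite K R] {f h : R}
    (hfh : Ideal.torsionOf R R f = Ideal.torsionOf R R h) :
    Module.finrank K (R ⧸ Ideal.span {f}) = Module.finrank K (R ⧸ Ideal.span {h}) := by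
  have rank_span (g : R) : Module.finrank K (R ⧸ Ideal.torsionOf R R g) =
      Module.finrank K (Ideal.span {g}) :=
    ((Ideal.quotTorsionOfEquivSpanSingleton R R g).restrictScalars K).finrank_eq
  have rank_f := finrank_quotient_add_finrank_of_tower (K := K) (Ideal.span {f})
  have rank_h := finrank_quotient_add_finrank_of_tower (K := K) (Ideal.span {h})
  rw [← rank_span] at rank_f rank_h
  rw [hfh] at rank_f
  omega

lemma finrank_quotient_sup_span_singleton_eq {L : Ideal R} [Module.Finite K (R ⧸ L)] {f h : R}
    (hfh : ∀ u, u * f ∈ L ↔ u * h ∈ L) :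
    Module.finrank K (R ⧸ L ⊔ Ideal.span {f}) = Module.finrank K (R ⧸ L ⊔ Ideal.span {h}) := by
  have double_quot (g : R) : Module.finrank K (R ⧸ L ⊔ Ideal.span {g}) =
      Module.finrank K ((R ⧸ L) ⧸ Ideal.span {Ideal.Quotient.mk L g}) := by
    rw [← (DoubleQuot.quotQuotEquivQuotSupₐ K L (Ideal.span {g})).toLinearEquiv.finrank_eq,
      Ideal.map_span, Set.image_singleton]
    rfl
  rw [double_quot, double_quot]
  refine finrank_quotient_span_singleton_eq (Ideal.ext fun u => ?_)
  obtain ⟨u, rfl⟩ := Ideal.Quotient.mk_surjective u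
  simpa only [Ideal.mem_torsionOf_iff, smul_eq_mul, ← map_mul, Ideal.Quotient.eq_zero_iff_mem]
    using hfh u

lemma hilbertFunction_eq_of_mul_mem_iff {A B : Type*} [CommRing A] [IsLocalRing A] [Algebra K A]
    [Module.Finite K A] [CommRing B] [IsLocalRing B] [Algebra K B]
    [Module.Finite K B] {M L : Ideal R} {f h : R} {d : ℕ} [∀ k, Module.Finite K (R ⧸ L ⊔ M ^ k)]
    {χ : R →ₐ[K] A} (hχ : Function.Surjective χ) (hM : M.map χ = maximalIdeal A)
    (ker_χ : RingHom.ker χ = L ⊔ Ideal.span {f})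
    {ψ : R →ₐ[K] B} (hψ : Function.Surjective ψ) (hN : M.map ψ = maximalIdeal B)
    (ker_ψ : RingHom.ker ψ = L ⊔ Ideal.span {h})
    (hfh : ∀ k ≤ d, ∀ u, u * f ∈ L ⊔ M ^ (k + 1) ↔ u * h ∈ L ⊔ M ^ (k + 1)) {j : ℕ} (hj : j ≤ d) :
    hilbertFunction K A j = hilbertFunction K B j := by
  have colength_eq (k : ℕ) (hk : k ≤ d + 1) : Module.finrank K (A ⧸ maximalIdeal A ^ k) =
      Module.finrank K (B ⧸ maximalIdeal B ^ k) := by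
    rw [finrank_quotient_maximalIdeal_pow hχ hM, finrank_quotient_maximalIdeal_pow hψ hN, ker_χ,
      ker_ψ, sup_right_comm L (Ideal.span {f}), sup_right_comm L (Ideal.span {h})]
    obtain _ | k := k
    · exact finrank_quotient_sup_span_singleton_eq (by simp)
    · exact finrank_quotient_sup_span_singleton_eq (hfh k (by omega))
  have layer_A := hilbertFunction_add_finrank (K := K) (A := A) j
  have layer_B := hilbertFunction_add_finrank (K := K) (A := B) j
  rw [colength_eq j (by omega), colength_eq (j + 1) (by omega)] at layer_A
  omega

end Length

section Quotient

lemma isMaximal_map_mk {R : Type*} [CommRing R] {M L : Ideal R} [M.IsMaximal] (hM : L ≤ M) :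
    (M.map (Ideal.Quotient.mk L)).IsMaximal :=
  Ideal.IsMaximal.map_of_surjective_of_ker_le Ideal.Quotient.mk_surjective (by rwa [Ideal.mk_ker])

lemma isLocalRing_quotient_of_pow_le {R : Type*} [CommRing R] {M L : Ideal R} [M.IsMaximal] {N : ℕ}
    (hN : M ^ N ≤ L) (hM : L ≤ M) : IsLocalRing (R ⧸ L) := by
  refine IsLocalRing.of_unique_max_ideal ⟨_, isMaximal_map_mk hM, fun I hI => ?_⟩
  refine ((isMaximal_map_mk hM).eq_of_le hI.ne_top (Ideal.map_le_iff_le_comap.mpr ?_)).symm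
  have := hI.isPrime.comap (Ideal.Quotient.mk L)
  refine Ideal.IsPrime.le_of_pow_le (n := N) (hN.trans fun r hr => ?_)
  rw [Ideal.mem_comap, Ideal.Quotient.eq_zero_iff_mem.mpr hr]
  exact zero_mem _

lemma finite_of_surjective_of_isIntegral {σ T Q : Type*} [Finite σ] [CommRing T] [CommRing Q]
    [Algebra T Q] {χ : MvPolynomial σ T →ₐ[T] Q} (hχ : Function.Surjective χ)
    (hint : ∀ j, IsIntegral T (χ (X j))) : Module.Finite T Q := by
  have : Algebra.FiniteType T Q := .of_surjective χ hχ
  have : Algebra.IsIntegral T Q := ⟨hχ.forall.mpr fun r => by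
    induction r using MvPolynomial.induction_on with
    | C t => exact χ.commutes t ▸ isIntegral_algebraMap
    | add p q hp hq => exact map_add χ p q ▸ hp.add hq
    | mul_X p j hp => exact map_mul χ p (X j) ▸ hp.mul (hint j)⟩
  exact Algebra.IsIntegral.finite

lemma isIntegral_of_aeval_pow_eq_zero {T Q : Type*} [CommRing T] [CommRing Q] [Algebra T Q] {y : Q}
    {p : Polynomial T} (hp : p.Monic) {N : ℕ} (hy : Polynomial.aeval y p ^ N = 0) :
    IsIntegral T y :=
  ⟨p ^ N, hp.pow N, by rwa [← Polynomial.aeval_def, map_pow]⟩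

lemma finite_of_axisIncl_pow_eq_zero {σ T Q : Type*} [Finite σ] [CommRing T] [CommRing Q]
    [Algebra T Q] {χ : MvPolynomial σ T →ₐ[T] Q} (hχ : Function.Surjective χ) {i : σ} {N : ℕ}
    {p : Polynomial T} (hp : p.Monic) (hi : χ (axisIncl i p) ^ N = 0)
    (hj : ∀ j, j ≠ i → χ (X j) ^ N = 0) : Module.Finite T Q := by
  refine finite_of_surjective_of_isIntegral hχ fun j => ?_
  obtain rfl | hne := eq_or_ne j i
  · exact isIntegral_of_aeval_pow_eq_zero hp (map_axisIncl j χ p ▸ hi)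
  · exact isIntegral_of_aeval_pow_eq_zero Polynomial.monic_X
      ((Polynomial.aeval_X (R := T) (χ (X j))).symm ▸ hj j hne)

lemma finite_quotient_of_idealOfVars_pow_le {σ R : Type*} [Finite σ] [CommRing R]
    {L : Ideal (MvPolynomial σ R)} {N : ℕ} (hN : idealOfVars σ R ^ N ≤ L) :
    Module.Finite R (MvPolynomial σ R ⧸ L) := by
  refine finite_of_surjective_of_isIntegral (Ideal.Quotient.mkₐ_surjective R L) fun j => ?_
  refine isIntegral_of_aeval_pow_eq_zero Polynomial.monic_X (N := N) ?_
  rw [Polynomial.aeval_X, ← map_pow]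
  exact Ideal.Quotient.eq_zero_iff_mem.mpr (hN (Ideal.pow_mem_pow (X_mem_idealOfVars j) _))

lemma idealOfVars_eq_ker_constantCoeff (σ R : Type*) [CommRing R] :
    idealOfVars σ R = RingHom.ker (constantCoeff : MvPolynomial σ R →+* R) := by
  refine le_antisymm (Ideal.span_le.mpr ?_) fun r hr => ?_
  · rintro _ ⟨j, rfl⟩
    exact constantCoeff_X R j
  · rw [← pow_one (idealOfVars σ R), mem_pow_idealOfVars_iff']
    intro x hx
    rw [(Finsupp.degree_eq_zero_iff x).mp (by omega)]
    exact hr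

instance isMaximal_idealOfVars (σ K : Type*) [Field K] : (idealOfVars σ K).IsMaximal := by
  rw [idealOfVars_eq_ker_constantCoeff]
  exact RingHom.ker_isMaximal_of_surjective _ fun a => ⟨C a, constantCoeff_C _ a⟩

end Quotient

section Presentation

variable {σ K A : Type*} [DecidableEq σ] [Field K] [CommRing A] [Algebra K A]

/-- The ideal `J = ker φ ∩ 𝔭_i` of the ray decomposition, for the ideal `ker φ` presented by
`φ`. -/
def axisKer (φ : MvPolynomial σ K →ₐ[K] A) (i : σ) : Ideal (MvPolynomial σ K) :=
  RingHom.ker φ ⊓ axisIdeal K i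

/-- The equation `α_i^(μ+1) - t α_i^μ - q` that cuts out the upper ray family, over any ring of
parameters `t`; the ray order is `μ + 1`. -/
def rayEquation {R : Type*} [CommRing R] (i : σ) (μ : ℕ) (q : MvPolynomial σ R) (t : R) :
    MvPolynomial σ R :=
  X i ^ (μ + 1) - C t * X i ^ μ - q

/-- A presentation `φ` of a local algebra `(A, 𝔫)` with `𝔫^(d+2) = 0` that is adapted to the
`i`-th axis: the kernel of `φ` has ray order `μ + 1` and contains the ray equation
`α_i^(μ+1) - q`, and the ideal generated by the images of the other coordinates is so small that
it is killed by `φ(α_i)^μ` and by `𝔫^d`, although `φ(α_i)^(d+1) ≠ 0`. -/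
structure IsRayPresentation [IsLocalRing A] (φ : MvPolynomial σ K →ₐ[K] A) (i : σ) (d μ : ℕ)
    (q : MvPolynomial σ K) : Prop where
  surjective : Function.Surjective φ
  map_idealOfVars : (idealOfVars σ K).map φ = maximalIdeal A
  maximalIdeal_pow : maximalIdeal A ^ (d + 2) = ⊥
  q_mem : q ∈ axisIdeal K i
  map_q : φ q = φ (X i) ^ (μ + 1)
  X_pow_dvd : ∀ r, φ r = 0 → Polynomial.X ^ (μ + 1) ∣ axisProj i r
  mul_X_pow : ∀ r ∈ axisIdeal K i, φ r * φ (X i) ^ μ = 0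
  axisIdeal_mul_pow : (axisIdeal K i).map φ * maximalIdeal A ^ d = ⊥
  X_pow_ne_zero : φ (X i) ^ (d + 1) ≠ 0

lemma axisProj_rayEquation {R : Type*} [CommRing R] {i : σ} {μ : ℕ} {q : MvPolynomial σ R}
    (hq : q ∈ axisIdeal R i) (t : R) :
    axisProj i (rayEquation i μ q t) = Polynomial.X ^ μ * (Polynomial.X - Polynomial.C t) := by
  have proj_C : axisProj i (C t : MvPolynomial σ R) = Polynomial.C t :=
    (axisProj i : MvPolynomial σ R →ₐ[R] _).commutes t
  simp only [rayEquation, map_sub, map_mul, map_pow, axisProj_X_self, proj_C,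
    mem_axisIdeal.mp hq]
  ring

lemma isUnit_aeval_of_coeff_zero_ne_zero {x : A} (hx : IsNilpotent x) {p : Polynomial K}
    (hp : p.coeff 0 ≠ 0) : IsUnit (Polynomial.aeval x p) := by
  rw [← Polynomial.divX_mul_X_add p, map_add, map_mul, Polynomial.aeval_X, Polynomial.aeval_C]
  exact ((Commute.all _ _).isNilpotent_mul_left hx).isUnit_add_right_of_commute
    (hp.isUnit.map _) (Commute.all _ _)

lemma exists_eq_X_pow_mul_of_ne_zero {p : Polynomial K} (hp : p ≠ 0) :
    ∃ k p', p = Polynomial.X ^ k * p' ∧ p'.coeff 0 ≠ 0 := by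
  obtain ⟨p', hp', not_dvd⟩ := Polynomial.exists_eq_pow_rootMultiplicity_mul_and_not_dvd p hp 0
  rw [Polynomial.C_0, sub_zero] at hp' not_dvd
  exact ⟨_, p', hp', fun h => not_dvd (Polynomial.X_dvd_iff.mpr h)⟩

lemma exists_aeval_mem_imp_X_pow_mem {x : A} (hx : IsNilpotent x) {p : Polynomial K} (hp : p ≠ 0) :
    ∃ k, Polynomial.X ^ k ∣ p ∧
      ∀ (I : Ideal A) (c : A), c * Polynomial.aeval x p ∈ I → c * x ^ k ∈ I := by
  obtain ⟨k, p', rfl, hp'⟩ := exists_eq_X_pow_mul_of_ne_zero hp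
  refine ⟨k, dvd_mul_right _ _, fun I c h => ?_⟩
  rw [map_mul, map_pow, Polynomial.aeval_X, ← mul_assoc] at h
  exact (Ideal.mul_unit_mem_iff_mem _ (isUnit_aeval_of_coeff_zero_ne_zero hx hp')).mp h

namespace IsRayPresentation

variable [IsLocalRing A] {φ : MvPolynomial σ K →ₐ[K] A} {i : σ} {d μ : ℕ} {q : MvPolynomial σ K}
  (h : IsRayPresentation φ i d μ q)

include h

lemma X_pow_eq_zero : φ (X i) ^ (d + 2) = 0 := by
  rw [← Ideal.mem_bot, ← h.maximalIdeal_pow, ← h.map_idealOfVars]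
  exact Ideal.pow_mem_pow (Ideal.mem_map_of_mem φ (X_mem_idealOfVars i)) _

lemma X_pow_notMem {j : ℕ} (hj : j ≤ d) :
    φ (X i) ^ (j + 1) ∉ (axisIdeal K i).map φ * maximalIdeal A ^ j := by
  intro hmem
  have map_X_mem : φ (X i) ∈ maximalIdeal A :=
    h.map_idealOfVars ▸ Ideal.mem_map_of_mem φ (X_mem_idealOfVars i)
  have := Ideal.mul_mem_mul hmem (Ideal.pow_mem_pow map_X_mem (d - j))
  rw [mul_assoc, ← pow_add, ← pow_add, Nat.add_right_comm, Nat.add_sub_cancel' hj,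
    h.axisIdeal_mul_pow] at this
  exact h.X_pow_ne_zero this

lemma one_le : 1 ≤ μ := by
  refine Nat.one_le_iff_ne_zero.mpr fun hμ => h.X_pow_notMem d.zero_le ?_
  have := Ideal.mem_map_of_mem φ h.q_mem
  simpa [h.map_q, hμ] using this

lemma le_succ : μ ≤ d + 1 := by
  have := h.X_pow_dvd (X i ^ (d + 2)) (by rw [map_pow, h.X_pow_eq_zero])
  rw [map_pow, axisProj_X_self,
    pow_dvd_pow_iff Polynomial.X_ne_zero Polynomial.not_isUnit_X] at this
  omega

lemma map_rayEquation (a : K) :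
    φ (rayEquation i μ q a) = -(algebraMap K A a * φ (X i) ^ μ) := by
  have map_C : φ (C a) = algebraMap K A a := φ.commutes a
  simp only [rayEquation, map_sub, map_mul, map_pow, map_C, h.map_q]
  ring

lemma mem_axisKer_sup_span_singleton_iff {e r : MvPolynomial σ K} {y : A}
    (he : φ e = y * φ (X i) ^ μ) :
    r ∈ axisKer φ i ⊔ Ideal.span {e} ↔ ∃ p, axisProj i r = p * axisProj i e ∧
      φ r = Polynomial.aeval (φ (X i)) p * (y * φ (X i) ^ μ) := by
  have mul_e (r : MvPolynomial σ K) (hr : axisProj i r = 0) : φ r * φ e = 0 := by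
    rw [he, mul_left_comm, h.mul_X_pow r hr, mul_zero]
  have key := mem_inf_ker_sup_span_singleton_iff (φ := φ.toRingHom) (π := (axisProj i).toRingHom)
    (ι := (axisIncl i).toRingHom) axisProj_axisIncl mul_e (m := r)
  refine key.trans (exists_congr fun p => and_congr_right fun _ => ?_)
  rw [← he, ← map_axisIncl]
  rfl

lemma mem_axisKer_sup_rayEquation_iff {a : K} {r : MvPolynomial σ K} :
    r ∈ axisKer φ i ⊔ Ideal.span {rayEquation i μ q a} ↔
      ∃ p, axisProj i r = p * (Polynomial.X ^ μ * (Polynomial.X - Polynomial.C a)) ∧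
        φ r = Polynomial.aeval (φ (X i)) p * (-algebraMap K A a * φ (X i) ^ μ) := by
  rw [h.mem_axisKer_sup_span_singleton_iff (y := -algebraMap K A a)
    (by rw [h.map_rayEquation, neg_mul]), axisProj_rayEquation h.q_mem]

lemma ker_eq : RingHom.ker φ = axisKer φ i ⊔ Ideal.span {rayEquation i μ q 0} := by
  ext r
  rw [h.mem_axisKer_sup_rayEquation_iff, RingHom.mem_ker]
  simp only [map_zero, sub_zero, neg_zero, zero_mul, mul_zero, ← pow_succ, exists_and_right]
  exact ⟨fun hr => ⟨(h.X_pow_dvd r hr).imp fun p hp => by rw [hp, mul_comm], hr⟩, And.right⟩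

lemma mem_axisKer_sup_pow_iff {k : ℕ} {r : MvPolynomial σ K} :
    r ∈ axisKer φ i ⊔ idealOfVars σ K ^ (k + 1) ↔ Polynomial.X ^ (k + 1) ∣ axisProj i r ∧
      φ r - Polynomial.aeval (φ (X i)) (axisProj i r) ∈
        (axisIdeal K i).map φ * maximalIdeal A ^ k := by
  rw [← map_axisIncl, ← map_sub, ← h.map_idealOfVars, ← Ideal.map_pow, ← Ideal.map_mul,
    Submodule.mem_sup]
  constructor
  · rintro ⟨j, ⟨hφj, hπj⟩, m, hm, rfl⟩
    rw [SetLike.mem_coe, RingHom.mem_ker] at hφj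
    rw [SetLike.mem_coe, mem_axisIdeal] at hπj
    obtain ⟨hX, hm⟩ := mem_idealOfVars_pow_succ_iff.mp hm
    rw [map_add (axisProj i), hπj, zero_add, map_sub, map_add, hφj, zero_add, ← map_sub]
    exact ⟨hX, Ideal.mem_map_of_mem φ hm⟩
  · rintro ⟨hX, hr⟩
    obtain ⟨m, hm, hφm⟩ := (Ideal.mem_map_iff_of_surjective φ h.surjective).mp hr
    have hπm : axisProj i m = 0 := Ideal.mul_le_left (I := axisIdeal K i) hm
    refine ⟨r - axisIncl i (axisProj i r) - m, ⟨?_, ?_⟩, axisIncl i (axisProj i r) + m, ?_, by ring⟩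
    · rw [SetLike.mem_coe, RingHom.mem_ker, map_sub, hφm, sub_self]
    · simp [mem_axisIdeal, hπm]
    · exact (mem_idealOfVars_pow_succ_iff (i := i)).mpr (by simpa [hπm] using ⟨hX, hm⟩)

lemma X_pow_dvd_of_mul_aeval_mem {k : ℕ} (hk : k ≤ d) {p : Polynomial K}
    (hp : φ (X i) * Polynomial.aeval (φ (X i)) p ∈
      (axisIdeal K i).map φ * maximalIdeal A ^ k) :
    Polynomial.X ^ (k + 1) ∣ p := by
  obtain rfl | p_ne := eq_or_ne p 0
  · exact dvd_zero _
  obtain ⟨l, dvd_p, mem⟩ := exists_aeval_mem_imp_X_pow_mem ⟨_, h.X_pow_eq_zero⟩ p_ne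
  refine (pow_dvd_pow _ (not_lt.mp fun hl => h.X_pow_notMem hk ?_)).trans dvd_p
  rw [← pow_mul_pow_sub _ (show l + 1 ≤ k + 1 by omega), pow_succ']
  exact Ideal.mul_mem_right _ _ (mem _ _ hp)

end IsRayPresentation

/-- The ideal of the component at the origin of the fibre of the upper ray family over `t = a`
with `a ≠ 0`: in the ray equation `α_i^μ (α_i - a) - q` the factor `α_i - a` is a unit near the
origin, with inverse represented by `w`. -/
def residualIdeal (φ : MvPolynomial σ K →ₐ[K] A) (i : σ) (μ : ℕ) (q w : MvPolynomial σ K) :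
    Ideal (MvPolynomial σ K) :=
  axisKer φ i ⊔ Ideal.span {X i ^ μ - w * q}

namespace IsRayPresentation

variable [IsLocalRing A] {φ : MvPolynomial σ K →ₐ[K] A} {i : σ} {d μ : ℕ} {q : MvPolynomial σ K}
  (h : IsRayPresentation φ i d μ q) {a : K} {w : MvPolynomial σ K}
  (hw : φ w * (φ (X i) - algebraMap K A a) = 1)

include h

lemma axisProj_residual : axisProj i (X i ^ μ - w * q) = Polynomial.X ^ μ := by
  simp [mem_axisIdeal.mp h.q_mem]

lemma exists_mul_sub_eq_one (ha : a ≠ 0) : ∃ w, φ w * (φ (X i) - algebraMap K A a) = 1 := by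
  have isUnit : IsUnit (φ (X i) - algebraMap K A a) := by
    have := isUnit_aeval_of_coeff_zero_ne_zero ⟨_, h.X_pow_eq_zero⟩
      (p := Polynomial.X - Polynomial.C a) (by simpa using ha)
    simpa using this
  obtain ⟨w, hw⟩ := h.surjective ↑(isUnit.unit⁻¹)
  exact ⟨w, by rw [hw, IsUnit.val_inv_mul]⟩

/- The residual equation vanishes in the second factor and takes the value `a ^ μ ≠ 0` in the
first one. -/
lemma surjective_prod_mk_residualIdeal (ha : a ≠ 0) :
    Function.Surjective (((Polynomial.aeval a).comp (axisProj i)).prod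
      (Ideal.Quotient.mkₐ K (residualIdeal φ i μ q w))) := by
  rintro ⟨b, y⟩
  obtain ⟨m, rfl⟩ := Ideal.Quotient.mk_surjective y
  refine ⟨m + C ((b - (axisProj i m).eval a) / a ^ μ) * (X i ^ μ - w * q), Prod.ext ?_ ?_⟩
  · have proj_C (c : K) : axisProj i (C c : MvPolynomial σ K) = Polynomial.C c :=
      (axisProj i : MvPolynomial σ K →ₐ[K] _).commutes c
    change (axisProj i (m + C _ * (X i ^ μ - w * q))).eval a = b
    simp only [map_add, map_mul, h.axisProj_residual, proj_C, Polynomial.eval_add,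
      Polynomial.eval_mul, Polynomial.eval_C, Polynomial.eval_pow, Polynomial.eval_X]
    field_simp
    ring
  · have : X i ^ μ - w * q ∈ residualIdeal φ i μ q w :=
      Ideal.mem_sup_right (Ideal.mem_span_singleton_self _)
    change Ideal.Quotient.mk _ (m + C _ * (X i ^ μ - w * q)) = Ideal.Quotient.mk _ m
    rw [map_add, map_mul, Ideal.Quotient.eq_zero_iff_mem.mpr this, mul_zero, add_zero]

include hw

lemma map_residual : φ (X i ^ μ - w * q) = -algebraMap K A a * φ w * φ (X i) ^ μ := by
  rw [map_sub, map_mul, map_pow, h.map_q]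
  linear_combination -φ (X i) ^ μ * hw

lemma mem_residualIdeal_iff {r : MvPolynomial σ K} :
    r ∈ residualIdeal φ i μ q w ↔ ∃ p, axisProj i r = p * Polynomial.X ^ μ ∧
      φ r = Polynomial.aeval (φ (X i)) p * (-algebraMap K A a * φ w * φ (X i) ^ μ) := by
  rw [residualIdeal, h.mem_axisKer_sup_span_singleton_iff (h.map_residual hw), h.axisProj_residual]

lemma mem_axisKer_sup_rayEquation_iff_mem_residualIdeal (ha : a ≠ 0) {r : MvPolynomial σ K} :
    r ∈ axisKer φ i ⊔ Ideal.span {rayEquation i μ q a} ↔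
      (axisProj i r).eval a = 0 ∧ r ∈ residualIdeal φ i μ q w := by
  rw [h.mem_axisKer_sup_rayEquation_iff, h.mem_residualIdeal_iff hw]
  have map_eq (p : Polynomial K) :
      Polynomial.aeval (φ (X i)) (p * (Polynomial.X - Polynomial.C a)) *
        (-algebraMap K A a * φ w * φ (X i) ^ μ) =
      Polynomial.aeval (φ (X i)) p * (-algebraMap K A a * φ (X i) ^ μ) := by
    simp only [map_mul, map_sub, Polynomial.aeval_X, Polynomial.aeval_C]
    linear_combination -Polynomial.aeval (φ (X i)) p * algebraMap K A a * φ (X i) ^ μ * hw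
  constructor
  · rintro ⟨p, hπ, hφ⟩
    exact ⟨by simp [hπ], p * (Polynomial.X - Polynomial.C a), by rw [hπ]; ring,
      by rw [hφ, map_eq]⟩
  · rintro ⟨heval, p, hπ, hφ⟩
    have root : p.IsRoot a := by simpa [hπ, ha] using heval
    obtain ⟨p, rfl⟩ := Polynomial.dvd_iff_isRoot.mpr root
    exact ⟨p, by rw [hπ]; ring, by rw [hφ, mul_comm (Polynomial.X - _), map_eq]⟩

lemma ker_prod_mk_residualIdeal (ha : a ≠ 0) :
    RingHom.ker (((Polynomial.aeval a).comp (axisProj i)).prod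
      (Ideal.Quotient.mkₐ K (residualIdeal φ i μ q w))) =
      axisKer φ i ⊔ Ideal.span {rayEquation i μ q a} := by
  ext r
  rw [h.mem_axisKer_sup_rayEquation_iff_mem_residualIdeal hw ha, RingHom.mem_ker,
    ← Ideal.Quotient.eq_zero_iff_mem]
  exact Prod.mk_eq_zero

lemma idealOfVars_pow_le_residualIdeal : idealOfVars σ K ^ (d + 1) ≤ residualIdeal φ i μ q w := by
  intro r hr
  obtain ⟨⟨p, hπ⟩, hφ⟩ := (h.mem_axisKer_sup_pow_iff).mp (Ideal.mem_sup_right hr)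
  rw [h.axisIdeal_mul_pow, Ideal.mem_bot, sub_eq_zero, hπ] at hφ
  refine (h.mem_residualIdeal_iff hw).mpr ⟨p * Polynomial.X ^ (d + 1 - μ), ?_, ?_⟩
  · rw [hπ, mul_assoc, pow_sub_mul_pow _ h.le_succ, mul_comm]
  · have pow_eq := pow_sub_mul_pow (φ (X i)) h.le_succ
    rw [hφ]
    simp only [map_mul, map_pow, Polynomial.aeval_X]
    linear_combination Polynomial.aeval (φ (X i)) p * (-φ (X i) ^ (d + 1) * hw +
      φ w * h.X_pow_eq_zero + algebraMap K A a * φ w * pow_eq)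

lemma residualIdeal_le_idealOfVars : residualIdeal φ i μ q w ≤ idealOfVars σ K := by
  intro r hr
  obtain ⟨p, hπ, -⟩ := (h.mem_residualIdeal_iff hw).mp hr
  rw [mem_idealOfVars_iff (i := i), hπ]
  exact (dvd_pow_self _ (Nat.one_le_iff_ne_zero.mp h.one_le)).mul_left p

lemma X_pow_notMem_residualIdeal : X i ^ d ∉ residualIdeal φ i μ q w := by
  intro mem
  obtain ⟨p, hπ, hφ⟩ := (h.mem_residualIdeal_iff hw).mp mem
  rw [map_pow, axisProj_X_self] at hπ
  have aeval_eq := congrArg (Polynomial.aeval (φ (X i))) hπ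
  simp only [map_mul, map_pow, Polynomial.aeval_X] at hφ aeval_eq
  have pow_eq_zero : φ (X i) ^ (d + 1) = 0 := by
    refine (IsUnit.of_mul_eq_one _ hw).mul_left_cancel ?_
    linear_combination φ (X i) ^ d * hw + hφ + algebraMap K A a * φ w * aeval_eq
  exact h.X_pow_ne_zero pow_eq_zero

lemma isLocalRing_quotient_residualIdeal :
    IsLocalRing (MvPolynomial σ K ⧸ residualIdeal φ i μ q w) :=
  isLocalRing_quotient_of_pow_le (h.idealOfVars_pow_le_residualIdeal hw)
    (h.residualIdeal_le_idealOfVars hw)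

lemma maximalIdeal_quotient_residualIdeal
    [IsLocalRing (MvPolynomial σ K ⧸ residualIdeal φ i μ q w)] :
    (idealOfVars σ K).map (Ideal.Quotient.mk (residualIdeal φ i μ q w)) = maximalIdeal _ :=
  IsLocalRing.eq_maximalIdeal (isMaximal_map_mk (h.residualIdeal_le_idealOfVars hw))

lemma isSocleDegree_quotient_residualIdeal
    [IsLocalRing (MvPolynomial σ K ⧸ residualIdeal φ i μ q w)] :
    IsSocleDegree (MvPolynomial σ K ⧸ residualIdeal φ i μ q w) d := by
  have pow_eq_bot_iff (k : ℕ) :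
      maximalIdeal (MvPolynomial σ K ⧸ residualIdeal φ i μ q w) ^ k = ⊥ ↔
        idealOfVars σ K ^ k ≤ residualIdeal φ i μ q w := by
    rw [← h.maximalIdeal_quotient_residualIdeal hw, ← Ideal.map_pow, Ideal.map_eq_bot_iff_le_ker,
      Ideal.mk_ker]
  constructor
  · rw [Set.mem_ofPred_eq, ne_eq, pow_eq_bot_iff]
    exact fun hle => h.X_pow_notMem_residualIdeal hw
      (hle (Ideal.pow_mem_pow (X_mem_idealOfVars i) d))
  · intro k hk
    by_contra! hdk
    exact hk ((pow_eq_bot_iff k).mpr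
      ((Ideal.pow_le_pow_right hdk).trans (h.idealOfVars_pow_le_residualIdeal hw)))

lemma mul_rayEquation_mem_iff_mul_residual_mem {k : ℕ} (hk : k ≤ d) (u : MvPolynomial σ K) :
    u * rayEquation i μ q 0 ∈ axisKer φ i ⊔ idealOfVars σ K ^ (k + 1) ↔
      u * (X i ^ μ - w * q) ∈ axisKer φ i ⊔ idealOfVars σ K ^ (k + 1) := by
  set p := axisProj i u * Polynomial.X ^ μ with hp
  set x := φ (X i)
  have proj_ray : axisProj i (u * rayEquation i μ q 0) = p * Polynomial.X := by
    rw [map_mul, axisProj_rayEquation h.q_mem, Polynomial.C_0, sub_zero, mul_assoc]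
  have proj_res : axisProj i (u * (X i ^ μ - w * q)) = p := by
    rw [map_mul, h.axisProj_residual]
  have map_u : φ u * x ^ μ = Polynomial.aeval x p := by
    have := h.mul_X_pow _ (sub_axisIncl_mem_axisIdeal u)
    rw [map_sub, map_axisIncl] at this
    rw [hp, map_mul, map_pow, Polynomial.aeval_X]
    linear_combination this
  have diff_ray : φ (u * rayEquation i μ q 0) - Polynomial.aeval x (p * Polynomial.X) =
      -(x * Polynomial.aeval x p) := by
    rw [map_mul, h.map_rayEquation, map_zero, map_mul, Polynomial.aeval_X]
    ring
  have diff_res : φ (u * (X i ^ μ - w * q)) - Polynomial.aeval x p =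
      -φ w * (x * Polynomial.aeval x p) := by
    rw [map_mul, h.map_residual hw]
    linear_combination -algebraMap K A a * φ w * map_u + Polynomial.aeval x p * hw
  rw [h.mem_axisKer_sup_pow_iff, h.mem_axisKer_sup_pow_iff, proj_ray, proj_res, diff_ray, diff_res,
    neg_mem_iff, Ideal.unit_mul_mem_iff_mem _ (IsUnit.of_mul_eq_one _ hw).neg]
  exact and_congr_left fun hmem =>
    have := h.X_pow_dvd_of_mul_aeval_mem hk hmem
    iff_of_true (this.mul_right _) this

end IsRayPresentation

lemma IsRayPresentation.hilbertFunction_quotient_residualIdeal [IsLocalRing A] [Module.Finite K A]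
    [Finite σ] {φ : MvPolynomial σ K →ₐ[K] A} {i : σ} {d μ : ℕ} {q : MvPolynomial σ K}
    (h : IsRayPresentation φ i d μ q) {a : K} {w : MvPolynomial σ K}
    (hw : φ w * (φ (X i) - algebraMap K A a) = 1)
    [IsLocalRing (MvPolynomial σ K ⧸ residualIdeal φ i μ q w)]
    [Module.Finite K (MvPolynomial σ K ⧸ residualIdeal φ i μ q w)] {j : ℕ} (hj : j ≤ d) :
    hilbertFunction K (MvPolynomial σ K ⧸ residualIdeal φ i μ q w) j = hilbertFunction K A j := by
  have (k : ℕ) : Module.Finite K (MvPolynomial σ K ⧸ axisKer φ i ⊔ idealOfVars σ K ^ k) :=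
    finite_quotient_of_idealOfVars_pow_le le_sup_right
  exact (hilbertFunction_eq_of_mul_mem_iff h.surjective h.map_idealOfVars h.ker_eq
    (Ideal.Quotient.mkₐ_surjective K _) (h.maximalIdeal_quotient_residualIdeal hw)
    (Ideal.Quotient.mkₐ_ker K _)
    (fun k hk u => h.mul_rayEquation_mem_iff_mul_residual_mem hw hk u) hj).symm

end Presentation

section Family

section Parameter

variable {σ R : Type*} [CommRing R]

variable (σ R) in
/-- The identification `R[t][α] ≃ R[α][t]`, used to argue coefficientwise in the parameter `t`. -/
def parameterEquiv : MvPolynomial σ (Polynomial R) ≃ₐ[R] Polynomial (MvPolynomial σ R) :=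
  (optionEquivRight R σ).symm.trans (optionEquivLeft R σ)

@[simp]
lemma parameterEquiv_X (j : σ) : parameterEquiv σ R (X j) = Polynomial.C (X j) := by
  rw [parameterEquiv, AlgEquiv.trans_apply, ← optionEquivRight_X_some, AlgEquiv.symm_apply_apply,
    optionEquivLeft_X_some]

lemma parameterEquiv_C (c : Polynomial R) : parameterEquiv σ R (C c) = c.map C := by
  have : (parameterEquiv σ R : MvPolynomial σ (Polynomial R) →+*
      Polynomial (MvPolynomial σ R)).comp C = Polynomial.mapRingHom C := by
    apply Polynomial.ringHom_ext
    · intro a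
      exact ((parameterEquiv σ R).commutes a).trans (by simp [Polynomial.algebraMap_apply])
    · change parameterEquiv σ R (C Polynomial.X) = _
      rw [parameterEquiv, AlgEquiv.trans_apply, ← optionEquivRight_X_none,
        AlgEquiv.symm_apply_apply, optionEquivLeft_X_none, Polynomial.coe_mapRingHom,
        Polynomial.map_X]
  exact DFunLike.congr_fun this c

lemma parameterEquiv_map_C (r : MvPolynomial σ R) :
    parameterEquiv σ R (map Polynomial.C r) = Polynomial.C r := by
  have : (parameterEquiv σ R : MvPolynomial σ (Polynomial R) →+*
      Polynomial (MvPolynomial σ R)).comp (map Polynomial.C) = Polynomial.C := by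
    apply ringHom_ext
    · intro a
      simp [parameterEquiv_C]
    · simp
  exact DFunLike.congr_fun this r

lemma mem_map_map_C_iff {I : Ideal (MvPolynomial σ R)} {r : MvPolynomial σ (Polynomial R)} :
    r ∈ I.map (map Polynomial.C) ↔ ∀ k, (parameterEquiv σ R r).coeff k ∈ I := by
  have map_eq : (I.map (map Polynomial.C)).map (parameterEquiv σ R) = I.map Polynomial.C := by
    rw [← Ideal.map_coe (parameterEquiv σ R), Ideal.map_map]
    congr 1
    exact RingHom.ext parameterEquiv_map_C
  rw [← Ideal.mem_map_C_iff, ← map_eq]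
  refine ⟨Ideal.mem_map_of_mem _, fun hr => ?_⟩
  obtain ⟨r', hr', heq⟩ := (Ideal.mem_map_iff_of_surjective _ (parameterEquiv σ R).surjective).mp hr
  rwa [← (parameterEquiv σ R).injective heq]

lemma map_axisIdeal [DecidableEq σ] (i : σ) :
    (axisIdeal R i).map (map Polynomial.C) = axisIdeal (Polynomial R) i := by
  rw [axisIdeal_eq_span, axisIdeal_eq_span, Ideal.map_span, ← Set.image_comp]
  congr 1
  exact Set.image_congr fun j _ => map_X _ _

end Parameter

variable {σ K A : Type*} [Field K] [CommRing A] [Algebra K A]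

/-- The base change `K[t][α] → A[t]` of a homomorphism `φ : K[α] → A` to the parameter ring
`K[t]`. -/
def parameterMap (φ : MvPolynomial σ K →ₐ[K] A) : MvPolynomial σ (Polynomial K) →+* Polynomial A :=
  (Polynomial.mapRingHom (φ : MvPolynomial σ K →+* A)).comp
    (parameterEquiv σ K : MvPolynomial σ (Polynomial K) →+* Polynomial (MvPolynomial σ K))

variable {φ : MvPolynomial σ K →ₐ[K] A}

lemma coeff_parameterMap (r : MvPolynomial σ (Polynomial K)) (k : ℕ) :
    (parameterMap φ r).coeff k = φ ((parameterEquiv σ K r).coeff k) :=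
  Polynomial.coeff_map _ _

lemma parameterMap_X (j : σ) : parameterMap φ (X j) = Polynomial.C (φ (X j)) := by
  simp [parameterMap]

lemma parameterMap_map_C (r : MvPolynomial σ K) :
    parameterMap φ (map Polynomial.C r) = Polynomial.C (φ r) := by
  simp [parameterMap, parameterEquiv_map_C]

lemma parameterMap_C (c : Polynomial K) :
    parameterMap φ (C c) = c.map (algebraMap K A) := by
  ext k
  rw [coeff_parameterMap, parameterEquiv_C, Polynomial.coeff_map, Polynomial.coeff_map]
  exact φ.commutes _

lemma eq_zero_of_map_mul_eq_zero {c : Polynomial K} (hc : c ≠ 0) {p : Polynomial A}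
    (h : c.map (algebraMap K A) * p = 0) : p = 0 := by
  have monic := (Polynomial.monic_mul_leadingCoeff_inv hc).map (algebraMap K A)
  rw [← monic.mul_right_eq_zero_iff, Polynomial.map_mul, mul_right_comm, h, zero_mul]

lemma exists_eq_mul_of_C_mul_eq_mul {R : Type*} [CommRing R] [IsDomain R] {G : Polynomial R}
    (hG : G.Monic) {c : R} (hc : c ≠ 0) {p f : Polynomial R} (h : Polynomial.C c * f = p * G) :
    ∃ y, f = y * G ∧ p = Polynomial.C c * y := by
  have dvd : G ∣ f := by
    rw [← Polynomial.modByMonic_eq_zero_iff_dvd hG, ← smul_eq_zero_iff_right hc,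
      ← Polynomial.smul_modByMonic, Polynomial.smul_eq_C_mul, h,
      Polynomial.modByMonic_eq_zero_iff_dvd hG]
    exact dvd_mul_left G p
  obtain ⟨y, rfl⟩ := dvd
  exact ⟨y, mul_comm _ _, hG.isRegular.right (by linear_combination -h)⟩

variable [DecidableEq σ] {i : σ} {d μ : ℕ} {q : MvPolynomial σ K}

lemma map_axisKer : (axisKer φ i).map (map Polynomial.C) =
    RingHom.ker (parameterMap φ) ⊓ axisIdeal (Polynomial K) i := by
  ext r
  rw [Submodule.mem_inf, ← map_axisIdeal, mem_map_map_C_iff, mem_map_map_C_iff, RingHom.mem_ker,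
    Polynomial.ext_iff, ← forall_and]
  refine forall_congr' fun k => ?_
  rw [coeff_parameterMap, Polynomial.coeff_zero]
  rfl

/-- The ideal of the upper ray family of the ray decomposition attached to `φ`. -/
def familyIdeal (φ : MvPolynomial σ K →ₐ[K] A) (i : σ) (μ : ℕ) (q : MvPolynomial σ K) :
    Ideal (MvPolynomial σ (Polynomial K)) :=
  (axisKer φ i).map (map Polynomial.C) ⊔
    Ideal.span {rayEquation i μ (map Polynomial.C q) Polynomial.X}

namespace IsRayPresentation

variable [IsLocalRing A] (h : IsRayPresentation φ i d μ q)

include h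

lemma map_q_mem : map Polynomial.C q ∈ axisIdeal (Polynomial K) i := by
  rw [← map_axisIdeal]
  exact Ideal.mem_map_of_mem _ h.q_mem

lemma parameterMap_rayEquation :
    parameterMap φ (rayEquation i μ (map Polynomial.C q) Polynomial.X) =
      -(Polynomial.X * Polynomial.C (φ (X i) ^ μ)) := by
  simp only [rayEquation, map_sub, map_mul, map_pow, parameterMap_X, parameterMap_map_C,
    parameterMap_C, Polynomial.map_X, h.map_q]
  ring

lemma mem_familyIdeal_iff {r : MvPolynomial σ (Polynomial K)} :
    r ∈ familyIdeal φ i μ q ↔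
      ∃ p, axisProj i r =
          p * (Polynomial.X ^ μ * (Polynomial.X - Polynomial.C Polynomial.X)) ∧
        parameterMap φ r = parameterMap φ (axisIncl i p) *
          parameterMap φ (rayEquation i μ (map Polynomial.C q) Polynomial.X) := by
  rw [familyIdeal, map_axisKer, ← axisProj_rayEquation h.map_q_mem]
  refine mem_inf_ker_sup_span_singleton_iff (φ := parameterMap φ) (π := (axisProj i).toRingHom)
    (ι := (axisIncl i).toRingHom) axisProj_axisIncl fun r hr => ?_
  have coeff_mem : ∀ k, (parameterEquiv σ K r).coeff k ∈ axisIdeal K i :=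
    mem_map_map_C_iff.mp (by rwa [map_axisIdeal])
  have : parameterMap φ r * Polynomial.C (φ (X i) ^ μ) = 0 := by
    ext k
    rw [Polynomial.coeff_mul_C, coeff_parameterMap, h.mul_X_pow _ (coeff_mem k),
      Polynomial.coeff_zero]
  rw [h.parameterMap_rayEquation]
  linear_combination -Polynomial.X * this

lemma mem_familyIdeal_of_C_mul_mem {c : Polynomial K} (hc : c ≠ 0)
    {r : MvPolynomial σ (Polynomial K)} (hr : C c * r ∈ familyIdeal φ i μ q) :
    r ∈ familyIdeal φ i μ q := by
  have map_C (y : Polynomial (Polynomial K)) :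
      axisIncl i (Polynomial.C c * y) = C c * axisIncl (σ := σ) i y := by
    rw [map_mul]
    congr 1
    exact (axisIncl i).commutes c
  obtain ⟨p, hπ, hφ⟩ := h.mem_familyIdeal_iff.mp hr
  have proj_C : axisProj i (C c : MvPolynomial σ _) = Polynomial.C c :=
    (axisProj i : MvPolynomial σ (Polynomial K) →ₐ[Polynomial K] _).commutes c
  rw [map_mul, proj_C] at hπ
  obtain ⟨y, hy, rfl⟩ := exists_eq_mul_of_C_mul_eq_mul
    ((Polynomial.monic_X_pow μ).mul (Polynomial.monic_X_sub_C _)) hc hπ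
  refine h.mem_familyIdeal_iff.mpr ⟨y, hy, sub_eq_zero.mp (eq_zero_of_map_mul_eq_zero hc ?_)⟩
  rw [map_mul, map_C, map_mul, parameterMap_C] at hφ
  linear_combination hφ

lemma flat_quotient_familyIdeal :
    Module.Flat (Polynomial K) (MvPolynomial σ (Polynomial K) ⧸ familyIdeal φ i μ q) := by
  rw [IsDedekindDomain.flat_iff_torsion_eq_bot, eq_bot_iff]
  rintro m ⟨⟨c, hc⟩, hcm⟩
  obtain ⟨r, rfl⟩ := Ideal.Quotient.mk_surjective m
  refine Ideal.Quotient.eq_zero_iff_mem.mpr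
    (h.mem_familyIdeal_of_C_mul_mem (nonZeroDivisors.ne_zero hc) ?_)
  rw [← Ideal.Quotient.eq_zero_iff_mem, ← hcm, ← smul_eq_C_mul]
  rfl

lemma map_C_pow_mem_familyIdeal {r : MvPolynomial σ K} (hr : r ∈ axisIdeal K i) :
    map Polynomial.C r ^ (d + 2) ∈ familyIdeal φ i μ q := by
  have axisIdeal_le : axisIdeal K i ≤ idealOfVars σ K := by
    rw [idealOfVars_eq_sup_axisIdeal (i := i)]
    exact le_sup_right
  have map_pow_eq_zero : φ (r ^ (d + 2)) = 0 := by
    rw [map_pow, ← Ideal.mem_bot, ← h.maximalIdeal_pow, ← h.map_idealOfVars]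
    exact Ideal.pow_mem_pow (Ideal.mem_map_of_mem φ (axisIdeal_le hr)) _
  rw [← map_pow]
  exact Ideal.mem_sup_left (Ideal.mem_map_of_mem _
    ⟨map_pow_eq_zero, Ideal.pow_mem_of_mem _ hr _ (by omega)⟩)

/- On the family `α_i ^ μ * (α_i - t)` equals the nilpotent element `q`. -/
lemma finite_quotient_familyIdeal [Finite σ] :
    Module.Finite (Polynomial K) (MvPolynomial σ (Polynomial K) ⧸ familyIdeal φ i μ q) := by
  have mk_pow_eq_zero {r : MvPolynomial σ K} (hr : r ∈ axisIdeal K i) :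
      Ideal.Quotient.mk (familyIdeal φ i μ q) (map Polynomial.C r) ^ (d + 2) = 0 := by
    rw [← map_pow]
    exact Ideal.Quotient.eq_zero_iff_mem.mpr (h.map_C_pow_mem_familyIdeal hr)
  refine finite_of_axisIncl_pow_eq_zero (T := Polynomial K) (i := i) (N := d + 2)
    (Q := MvPolynomial σ (Polynomial K) ⧸ familyIdeal φ i μ q)
    (χ := Ideal.Quotient.mkₐ (Polynomial K) (familyIdeal φ i μ q))
    (Ideal.Quotient.mkₐ_surjective (Polynomial K) (familyIdeal φ i μ q))
    ((Polynomial.monic_X_pow μ).mul (Polynomial.monic_X_sub_C Polynomial.X)) ?_ fun j hj => ?_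
  · have ray_mem : rayEquation i μ (map Polynomial.C q) Polynomial.X ∈ familyIdeal φ i μ q :=
      Ideal.mem_sup_right (Ideal.mem_span_singleton_self _)
    refine Eq.trans (congrArg (· ^ (d + 2)) (Ideal.Quotient.eq.mpr ?_)) (mk_pow_eq_zero h.q_mem)
    convert ray_mem using 1
    simp only [axisIncl, rayEquation, map_mul, map_sub, map_pow, Polynomial.aeval_X,
      Polynomial.aeval_C, MvPolynomial.algebraMap_eq]
    ring
  · rw [← map_X Polynomial.C]
    exact mk_pow_eq_zero (axisProj_X_of_ne hj)

end IsRayPresentation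

end Family

section FamilyFibre

lemma ker_mapAlgHom_aeval {σ R : Type*} [CommRing R] (a : R) :
    RingHom.ker (mapAlgHom (σ := σ) (Polynomial.aeval a : Polynomial R →ₐ[R] R)) =
      Ideal.span {C (Polynomial.X - Polynomial.C a)} := by
  have ker_aeval : RingHom.ker (Polynomial.aeval a : Polynomial R →ₐ[R] R) =
      Ideal.span {Polynomial.X - Polynomial.C a} := by
    rw [← Polynomial.ker_evalRingHom, ← Polynomial.coe_aeval_eq_evalRingHom]
    rfl
  have ker_map := MvPolynomial.ker_map (σ := σ)
    (Polynomial.aeval a : Polynomial R →ₐ[R] R).toRingHom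
  rw [← Set.image_singleton, ← Ideal.map_span, ← ker_aeval]
  exact ker_map

lemma map_familyIdeal {σ K A : Type*} [DecidableEq σ] [Field K] [CommRing A] [Algebra K A]
    (φ : MvPolynomial σ K →ₐ[K] A) (i : σ) (μ : ℕ) (q : MvPolynomial σ K) (a : K) :
    (familyIdeal φ i μ q).map (mapAlgHom (Polynomial.aeval a : Polynomial K →ₐ[K] K)) =
      axisKer φ i ⊔ Ideal.span {rayEquation i μ q a} := by
  have map_map_C (r : MvPolynomial σ K) : mapAlgHom (Polynomial.aeval a : Polynomial K →ₐ[K] K)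
      (map Polynomial.C r) = r := by
    rw [mapAlgHom_apply, map_map]
    convert map_id r
    ext b
    simp
  have map_rayEquation : mapAlgHom (Polynomial.aeval a : Polynomial K →ₐ[K] K)
      (rayEquation i μ (map Polynomial.C q) Polynomial.X) = rayEquation i μ q a := by
    rw [rayEquation, map_sub, map_map_C]
    simp [rayEquation]
  rw [familyIdeal, Ideal.map_sup, Ideal.map_span, Set.image_singleton, map_rayEquation,
    ← Ideal.map_coe, Ideal.map_map,
    RingHom.ext (f := RingHom.comp _ _) (g := RingHom.id _) map_map_C, Ideal.map_id]

lemma exists_fibre_algEquiv_of_ker_eq {K : Type u} [Field K] {F B : Type*} [CommRing F] [CommRing B]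
    [Algebra (Polynomial K) F] [Algebra K F] [Algebra K B] {a : K} {ψ : F →ₐ[K] B}
    (hψ : Function.Surjective ψ)
    (hker : RingHom.ker ψ =
      Ideal.span {algebraMap (Polynomial K) F (Polynomial.X - Polynomial.C a)}) :
    ∃ e : Fibre F a ≃ₐ[K] B, ∀ y, e (Ideal.Quotient.mk _ y) = ψ y :=
  ⟨(Ideal.quotientEquivAlgOfEq K hker.symm).trans (Ideal.quotientKerAlgEquivOfSurjective hψ),
    fun _ => rfl⟩

lemma exists_fibre_algEquiv {σ : Type*} {K : Type u} [Field K] {B : Type*} [CommRing B]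
    [Algebra K B] {L : Ideal (MvPolynomial σ (Polynomial K))} {a : K}
    {χ : MvPolynomial σ K →ₐ[K] B} (hχ : Function.Surjective χ)
    (hL : L.map (mapAlgHom (Polynomial.aeval a : Polynomial K →ₐ[K] K)) = RingHom.ker χ) :
    ∃ e : Fibre (MvPolynomial σ (Polynomial K) ⧸ L) a ≃ₐ[K] B,
      ∀ j, e (Ideal.Quotient.mk _ (Ideal.Quotient.mk L (X j))) = χ (X j) := by
  set ev := mapAlgHom (σ := σ) (Polynomial.aeval a : Polynomial K →ₐ[K] K) with ev_def
  have ev_surjective : Function.Surjective ev :=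
    map_surjective _ fun b => ⟨Polynomial.C b, Polynomial.aeval_C a b⟩
  have ker_comp : RingHom.ker (χ.comp ev) = L ⊔ Ideal.span {C (Polynomial.X - Polynomial.C a)} := by
    rw [← ker_mapAlgHom_aeval, ← ev_def, ← Ideal.comap_map_of_surjective' ev ev_surjective, hL]
    rfl
  have le_ker : L ≤ RingHom.ker (χ.comp ev) := ker_comp ▸ le_sup_left
  obtain ⟨e, he⟩ := exists_fibre_algEquiv_of_ker_eq (F := MvPolynomial σ (Polynomial K) ⧸ L)
    (ψ := Ideal.Quotient.liftₐ L (χ.comp ev) le_ker) (a := a)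
    (Ideal.Quotient.lift_surjective_of_surjective L le_ker (hχ.comp ev_surjective)) (by
      refine (Ideal.ker_quotient_lift (χ.comp ev).toRingHom le_ker).trans ?_
      change Ideal.map _ (RingHom.ker (χ.comp ev)) = _
      rw [ker_comp, Ideal.map_sup, Ideal.map_quotient_self, bot_sup_eq, Ideal.map_span,
        Set.image_singleton]
      rfl)
  refine ⟨e, fun j => ?_⟩
  rw [he]
  change χ (ev (X j)) = χ (X j)
  rw [ev_def, mapAlgHom_apply, map_X]

end FamilyFibre

section PowerSeries

section Extension

variable {σ K A : Type*} [Finite σ] [CommRing K] [CommRing A] [Algebra K A]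
  {φ : MvPolynomial σ K →ₐ[K] A} {N : ℕ} (hφ : idealOfVars σ K ^ N ≤ RingHom.ker φ)

include hφ

/-- The extension to power series of a homomorphism `φ` that kills the polynomials of order at
least `N`: truncate, then apply `φ`. -/
def powerSeriesHom : MvPowerSeries σ K →ₐ[K] A :=
  (Ideal.Quotient.liftₐ (idealOfVars σ K ^ N) φ hφ).comp
    ((MvPowerSeries.truncTotalAlgHom σ K N).restrictScalars K)

lemma powerSeriesHom_apply (f : MvPowerSeries σ K) :
    powerSeriesHom hφ f = φ (MvPowerSeries.truncTotal N f) :=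
  rfl

lemma powerSeriesHom_coe (r : MvPolynomial σ K) :
    powerSeriesHom hφ (r : MvPowerSeries σ K) = φ r := by
  rw [powerSeriesHom_apply, ← sub_eq_zero, ← map_sub]
  refine hφ ((mem_pow_idealOfVars_iff' ..).mpr fun x hx => ?_)
  rw [coeff_sub, MvPowerSeries.coeff_truncTotal _ hx, coeff_coe, sub_self]

lemma powerSeriesHom_surjective (surj : Function.Surjective φ) :
    Function.Surjective (powerSeriesHom hφ) := by
  intro a
  obtain ⟨r, rfl⟩ := surj a
  exact ⟨r, powerSeriesHom_coe hφ r⟩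

end Extension

variable {K : Type u} [Field K] {n : ℕ} {i : Fin n}

lemma rayProj_coe (r : MvPolynomial (Fin n) K) :
    rayProj K i (r : MvPowerSeries (Fin n) K) = (axisProj i r : PowerSeries K) := by
  have : (rayProj K i).comp (coeToMvPowerSeries.algHom K) =
      (Polynomial.coeToPowerSeries.algHom K).comp (axisProj i) := by
    ext j : 1
    simp only [AlgHom.comp_apply, coeToMvPowerSeries.algHom_apply, coe_X,
      Polynomial.coeToPowerSeries.algHom_apply]
    obtain rfl | hj := eq_or_ne j i
    · rw [axisProj_X_self, Polynomial.coe_X]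
      exact MvPowerSeries.killCompl_X (R := K)
        (e := (⟨fun _ : Unit => j, Function.injective_of_subsingleton _⟩ : Unit ↪ Fin n)) ()
    · rw [axisProj_X_of_ne hj, Polynomial.coe_zero]
      exact MvPowerSeries.killCompl_X_eq_zero (by rintro ⟨_, rfl⟩; exact hj rfl)
  simpa using DFunLike.congr_fun this r

lemma rayProj_surjective : Function.Surjective (rayProj K i) := fun g =>
  ⟨MvPowerSeries.rename (⟨fun _ : Unit => i, Function.injective_of_subsingleton _⟩ : Unit ↪ Fin n)
    g, MvPowerSeries.killCompl_rename_app g⟩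

lemma coeff_rayProj (f : MvPowerSeries (Fin n) K) (m : ℕ) :
    PowerSeries.coeff m (rayProj K i f) = MvPowerSeries.coeff (Finsupp.single i m) f := by
  rw [PowerSeries.coeff, rayProj, MvPowerSeries.coeff_killCompl, Finsupp.embDomain_single]
  rfl

lemma coeff_axisProj_truncTotal {m N : ℕ} (hm : m < N) (f : MvPowerSeries (Fin n) K) :
    (axisProj i (MvPowerSeries.truncTotal N f)).coeff m = PowerSeries.coeff m (rayProj K i f) := by
  rw [← Polynomial.coeff_coe, ← rayProj_coe, coeff_rayProj, coeff_rayProj, coeff_coe,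
    MvPowerSeries.coeff_truncTotal _ (by rwa [Finsupp.degree_single])]

lemma coe_X_pow_sub (m : ℕ) (q : MvPolynomial (Fin n) K) :
    ((X i ^ m - q : MvPolynomial (Fin n) K) : MvPowerSeries (Fin n) K) =
      MvPowerSeries.X i ^ m - (q : MvPowerSeries (Fin n) K) := by
  simpa using (coeToMvPowerSeries.ringHom (σ := Fin n) (R := K)).map_sub (X i ^ m) q

namespace IsRayPresentation

variable {A : Type*} [CommRing A] [IsLocalRing A] [Algebra K A]
  {φ : MvPolynomial (Fin n) K →ₐ[K] A} {d μ : ℕ} {q : MvPolynomial (Fin n) K}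
  (h : IsRayPresentation φ i d μ q)

include h

lemma idealOfVars_pow_le_ker : idealOfVars (Fin n) K ^ (d + 2) ≤ RingHom.ker φ := by
  rw [← Ideal.map_eq_bot_iff_le_ker, Ideal.map_pow, h.map_idealOfVars, h.maximalIdeal_pow]

/-- The ideal of the power series ring that is presented by `φ`. -/
def powerSeriesIdeal : Ideal (MvPowerSeries (Fin n) K) :=
  RingHom.ker (powerSeriesHom h.idealOfVars_pow_le_ker)

lemma nonempty_algEquiv_quotient_powerSeriesIdeal :
    Nonempty (A ≃ₐ[K] (MvPowerSeries (Fin n) K ⧸ h.powerSeriesIdeal)) :=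
  ⟨(Ideal.quotientKerAlgEquivOfSurjective
    (powerSeriesHom_surjective h.idealOfVars_pow_le_ker h.surjective)).symm⟩

lemma X_pow_dvd_rayProj {f : MvPowerSeries (Fin n) K} (hf : f ∈ h.powerSeriesIdeal) :
    PowerSeries.X ^ (μ + 1) ∣ rayProj K i f := by
  refine PowerSeries.X_pow_dvd_iff.mpr fun m hm => ?_
  rw [← coeff_axisProj_truncTotal (N := d + 2) (by have := h.le_succ; omega)]
  exact Polynomial.X_pow_dvd_iff.mp (h.X_pow_dvd _ hf) m hm

lemma X_pow_sub_q_mem : MvPowerSeries.X i ^ (μ + 1) - (q : MvPowerSeries (Fin n) K) ∈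
    h.powerSeriesIdeal := by
  rw [← coe_X_pow_sub, powerSeriesIdeal, RingHom.mem_ker, powerSeriesHom_coe, map_sub, h.map_q,
    map_pow, sub_self]

lemma rayProj_q : rayProj K i (q : MvPowerSeries (Fin n) K) = 0 := by
  rw [rayProj_coe, mem_axisIdeal.mp h.q_mem, Polynomial.coe_zero]

lemma rayProj_X_pow_sub_q :
    rayProj K i (MvPowerSeries.X i ^ (μ + 1) - (q : MvPowerSeries (Fin n) K)) =
      PowerSeries.X ^ (μ + 1) := by
  rw [map_sub, h.rayProj_q, sub_zero, map_pow, ← coe_X, rayProj_coe, axisProj_X_self,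
    Polynomial.coe_X]

lemma isRayOrder : IsRayOrder h.powerSeriesIdeal i (μ + 1) := by
  refine le_antisymm (Ideal.map_le_iff_le_comap.mpr fun f hf => ?_) ?_
  · exact Ideal.mem_span_singleton.mpr (h.X_pow_dvd_rayProj hf)
  · rw [Ideal.span_singleton_le_iff_mem, ← h.rayProj_X_pow_sub_q]
    exact Ideal.mem_map_of_mem _ h.X_pow_sub_q_mem

lemma powerSeriesIdeal_eq_sup : h.powerSeriesIdeal = h.powerSeriesIdeal ⊓ rayIdeal K i ⊔
    Ideal.span {MvPowerSeries.X i ^ (μ + 1) - (q : MvPowerSeries (Fin n) K)} := by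
  refine le_antisymm (fun f hf => ?_)
    (sup_le inf_le_left ((Ideal.span_singleton_le_iff_mem _).mpr h.X_pow_sub_q_mem))
  obtain ⟨g, hg⟩ := h.X_pow_dvd_rayProj hf
  obtain ⟨g, rfl⟩ := rayProj_surjective (i := i) g
  rw [sup_comm, Ideal.mem_span_singleton_sup]
  refine ⟨g, f - g * (MvPowerSeries.X i ^ (μ + 1) - (q : MvPowerSeries (Fin n) K)),
    ⟨?_, ?_⟩, by ring⟩
  · exact sub_mem hf (Ideal.mul_mem_left _ _ h.X_pow_sub_q_mem)
  · rw [SetLike.mem_coe, rayIdeal, RingHom.mem_ker, map_sub, map_mul, h.rayProj_X_pow_sub_q, hg]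
    ring

/-- The ray decomposition of `powerSeriesIdeal`, with `J` as large as possible. -/
def rayDecomposition : RayDecomposition h.powerSeriesIdeal i where
  J := h.powerSeriesIdeal ⊓ rayIdeal K i
  q := q
  ν := μ + 1
  J_le := le_rfl
  q_mem := h.rayProj_q
  eq_sup := h.powerSeriesIdeal_eq_sup

lemma polyJ_rayDecomposition : h.rayDecomposition.polyJ = axisKer φ i := by
  ext r
  change powerSeriesHom _ (r : MvPowerSeries (Fin n) K) = 0 ∧ rayProj K i r = 0 ↔
    φ r = 0 ∧ axisProj i r = 0
  rw [powerSeriesHom_coe, rayProj_coe, Polynomial.coe_eq_zero_iff]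

lemma upperRayIdeal_rayDecomposition :
    h.rayDecomposition.upperRayIdeal = familyIdeal φ i μ q := by
  rw [RayDecomposition.upperRayIdeal, polyJ_rayDecomposition]
  rfl

lemma isUpperRayDegeneration : h.rayDecomposition.IsUpperRayDegeneration := by
  unfold RayDecomposition.IsUpperRayDegeneration RayDecomposition.UpperRayFamily
  rw [upperRayIdeal_rayDecomposition]
  exact h.flat_quotient_familyIdeal

lemma finite_upperRayFamily : Module.Finite (Polynomial K) h.rayDecomposition.UpperRayFamily := by
  unfold RayDecomposition.UpperRayFamily
  rw [upperRayIdeal_rayDecomposition]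
  exact h.finite_quotient_familyIdeal

lemma exists_fibre_upperRayFamily_algEquiv {a : K} {B : Type*} [CommRing B] [Algebra K B]
    {χ : MvPolynomial (Fin n) K →ₐ[K] B} (hχ : Function.Surjective χ)
    (hker : RingHom.ker χ = axisKer φ i ⊔ Ideal.span {rayEquation i μ q a}) :
    ∃ e : Fibre h.rayDecomposition.UpperRayFamily a ≃ₐ[K] B,
      ∀ j, e (fibreCoord h.rayDecomposition a j) = χ (X j) := by
  refine exists_fibre_algEquiv hχ ?_
  rw [upperRayIdeal_rayDecomposition, map_familyIdeal, hker]

end IsRayPresentation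

end PowerSeries

section Existence

section SocleDegree

variable {A : Type*} [CommRing A] [IsLocalRing A] {s : ℕ}

lemma IsSocleDegree.maximalIdeal_pow_succ (hs : IsSocleDegree A s) :
    maximalIdeal A ^ (s + 1) = ⊥ :=
  not_not.mp fun h => (hs.2 h).not_gt s.lt_succ_self

lemma IsSocleDegree.exists_pow_ne_zero (hs : IsSocleDegree A s) (hu : IsUnit (s.factorial : A)) :
    ∃ x ∈ maximalIdeal A, x ^ s ≠ 0 := by
  by_contra! h
  exact hs.1 (pow_eq_bot_of_forall_pow_eq_zero hu h)

lemma pow_notMem_pow_succ {R : Type*} [CommRing R] {I : Ideal R} (hI : I ^ (s + 1) = ⊥) {x : R}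
    (hx : x ∈ I) (hxs : x ^ s ≠ 0) {j : ℕ} (hj : j ≤ s) : x ^ j ∉ I ^ (j + 1) := by
  intro hmem
  have := Ideal.mul_mem_mul hmem (Ideal.pow_mem_pow hx (s - j))
  rw [← pow_add, ← pow_add, Nat.add_right_comm, Nat.add_sub_cancel' hj, hI] at this
  exact hxs this

end SocleDegree

section Generators

variable {K : Type u} [Field K] {A : Type v} [CommRing A] [IsLocalRing A] [Algebra K A]

lemma span_range_eq_maximalIdeal_pow [IsNoetherianRing A] {ι : Type*} {k : ℕ}
    {g : ι → ↥(maximalIdeal A ^ k)}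
    (hg : ⊤ ≤ Submodule.span K (Set.range fun j =>
      ((maximalIdeal A ^ (k + 1)).submoduleOf (maximalIdeal A ^ k)).mkQ (g j))) :
    Ideal.span (Set.range fun j => (g j : A)) = maximalIdeal A ^ k := by
  set G := Ideal.span (Set.range fun j => (g j : A))
  set N := (maximalIdeal A ^ (k + 1)).submoduleOf (maximalIdeal A ^ k)
  refine le_antisymm (Ideal.span_le.mpr ?_) (Submodule.le_of_le_smul_of_le_jacobson_bot
    (IsNoetherian.noetherian _) (IsLocalRing.maximalIdeal_le_jacobson _) fun a ha => ?_)
  · rintro _ ⟨j, rfl⟩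
    exact (g j).2
  · obtain ⟨b, hb, hba⟩ : ∃ b ∈ Submodule.span K (Set.range g),
        N.mkQ.restrictScalars K b = N.mkQ ⟨a, ha⟩ := by
      rw [← Submodule.mem_map, Submodule.map_span, ← Set.range_comp]
      exact hg trivial
    have b_mem : (b : A) ∈ G := by
      have span_le : Submodule.span K (Set.range g) ≤
          (Submodule.comap (maximalIdeal A ^ k).subtype G).restrictScalars K :=
        Submodule.span_le.mpr (Set.range_subset_iff.mpr fun j => Submodule.subset_span ⟨j, rfl⟩)
      exact span_le hb
    have sub_mem : a - b ∈ maximalIdeal A ^ (k + 1) :=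
      (Submodule.Quotient.eq N).mp hba.symm
    rw [pow_succ'] at sub_mem
    exact Submodule.mem_sup.mpr ⟨b, b_mem, a - b, sub_mem, add_sub_cancel _ _⟩

lemma span_singleton_eq_maximalIdeal_pow [IsNoetherianRing A] {k : ℕ}
    (hk : hilbertFunction K A k = 1) {y : A} (hy : y ∈ maximalIdeal A ^ k)
    (hy' : y ∉ maximalIdeal A ^ (k + 1)) : Ideal.span {y} = maximalIdeal A ^ k := by
  have mk_ne : ((maximalIdeal A ^ (k + 1)).submoduleOf (maximalIdeal A ^ k)).mkQ ⟨y, hy⟩ ≠ 0 :=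
    (Submodule.Quotient.mk_eq_zero _).not.mpr hy'
  rw [← span_range_eq_maximalIdeal_pow (K := K) (g := fun _ : Unit => ⟨y, hy⟩), Set.range_const]
  rw [Set.range_const]
  exact ((finrank_eq_one_iff_of_nonzero _ mk_ne).mp hk).ge

lemma exists_basis_apply_eq {V : Type*} [AddCommGroup V] [Module K V] [Module.Finite K V]
    {v : V} (hv : v ≠ 0) {n : ℕ} (hn : Module.finrank K V = n) :
    ∃ (i : Fin n) (b : Module.Basis (Fin n) K V), b i = v := by
  have indep : LinearIndepOn K id {v} := LinearIndepOn.singleton hv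
  let b := Module.Basis.extend indep
  have : Finite (indep.extend (Set.subset_univ _)) := Module.Finite.finite_basis b
  let e := Finite.equivFinOfCardEq ((Module.finrank_eq_nat_card_basis b).symm.trans hn)
  exact ⟨e ⟨v, indep.subset_extend _ rfl⟩, b.reindex e, by simp [b]⟩

lemma exists_generators_maximalIdeal [Module.Finite K A] {n : ℕ} (hn : hilbertFunction K A 1 = n)
    {x : A} (hx : x ∈ maximalIdeal A) (hx' : x ∉ maximalIdeal A ^ 2) :
    ∃ (i : Fin n) (g : Fin n → A), g i = x ∧ Ideal.span (Set.range g) = maximalIdeal A := by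
  have : IsNoetherianRing A := IsNoetherianRing.of_finite K A
  have : Module.Finite K ↥(maximalIdeal A ^ 1) :=
    .of_injective ((maximalIdeal A ^ 1).subtype.restrictScalars K) Subtype.val_injective
  set N := (maximalIdeal A ^ (1 + 1)).submoduleOf (maximalIdeal A ^ 1)
  obtain ⟨y, rfl⟩ : ∃ y : ↥(maximalIdeal A ^ 1), (y : A) = x := ⟨⟨x, by rwa [pow_one]⟩, rfl⟩
  obtain ⟨i, b, hb⟩ := exists_basis_apply_eq (K := K) (v := N.mkQ y)
    ((Submodule.Quotient.mk_eq_zero _).not.mpr hx') hn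
  have exists_lift (j : Fin n) : ∃ z, N.mkQ z = b j ∧ (j = i → z = y) := by
    obtain rfl | hj := eq_or_ne j i
    · exact ⟨y, hb.symm, fun _ => rfl⟩
    · exact (N.mkQ_surjective (b j)).imp fun _ hz => ⟨hz, fun h => absurd h hj⟩
  choose g hg hgi using exists_lift
  refine ⟨i, fun j => g j, congrArg _ (hgi i rfl), ?_⟩
  rw [span_range_eq_maximalIdeal_pow (K := K), pow_one]
  exact (congrArg (Submodule.span K ∘ Set.range) (funext hg)).trans b.span_eq |>.ge

lemma span_range_sub_mul {R ι : Type*} [CommRing R] {i : ι} (g : ι → R) {a : ι → R}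
    (ha : a i = 0) :
    Ideal.span (Set.range fun j => g j - a j * g i) = Ideal.span (Set.range g) := by
  have mem (f : ι → R) (j : ι) : f j ∈ Ideal.span (Set.range f) := Ideal.subset_span ⟨j, rfl⟩
  refine le_antisymm (Ideal.span_le.mpr ?_) (Ideal.span_le.mpr ?_) <;> rintro _ ⟨j, rfl⟩ <;>
    rw [SetLike.mem_coe]
  · exact sub_mem (mem g j) (Ideal.mul_mem_left _ _ (mem g i))
  · have := add_mem (mem (fun j => g j - a j * g i) j)
      (Ideal.mul_mem_left _ (a j) (mem (fun j => g j - a j * g i) i))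
    simpa only [ha, zero_mul, sub_zero, sub_add_cancel] using this

lemma exists_generators_mul_pow_eq_zero [Module.Finite K A] {n c : ℕ}
    (hn : hilbertFunction K A 1 = n) {x : A} (hx : x ∈ maximalIdeal A)
    (hx' : x ∉ maximalIdeal A ^ 2) (hc : Ideal.span {x ^ (c + 1)} = maximalIdeal A ^ (c + 1)) :
    ∃ (i : Fin n) (g : Fin n → A), g i = x ∧ Ideal.span (Set.range g) = maximalIdeal A ∧
      ∀ j ≠ i, g j * x ^ c = 0 := by
  obtain ⟨i, g, rfl, hg⟩ := exists_generators_maximalIdeal hn hx hx'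
  have exists_coeff (j : Fin n) : ∃ a, a * g i ^ (c + 1) = g j * g i ^ c := by
    rw [← Ideal.mem_span_singleton', hc, pow_succ', ← hg]
    have g_mem (j : Fin n) : g j ∈ Ideal.span (Set.range g) := Ideal.subset_span ⟨j, rfl⟩
    exact Ideal.mul_mem_mul (g_mem j) (Ideal.pow_mem_pow (g_mem i) c)
  choose a ha using exists_coeff
  refine ⟨i, fun j => g j - Function.update a i 0 j * g i, by simp,
    by rw [span_range_sub_mul g (Function.update_self i 0 a), hg], fun j hj => ?_⟩
  simp only [Function.update_of_ne hj, sub_mul, ← ha j]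
  ring

end Generators

section Surjective

variable {σ K A : Type*} [Field K] [CommRing A] [Algebra K A]

lemma map_aeval_idealOfVars (g : σ → A) :
    (idealOfVars σ K).map (aeval g : MvPolynomial σ K →ₐ[K] A) = Ideal.span (Set.range g) := by
  rw [idealOfVars, Ideal.map_span, ← Set.range_comp]
  simp [Function.comp_def]

variable [IsLocalRing A] {φ : MvPolynomial σ K →ₐ[K] A}

lemma exists_sub_mem_maximalIdeal_pow (hres : Function.Surjective (algebraMap K (ResidueField A)))
    (hφ : (idealOfVars σ K).map φ = maximalIdeal A) (k : ℕ) (a : A) :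
    ∃ r, a - φ r ∈ maximalIdeal A ^ k := by
  induction k generalizing a with
  | zero => exact ⟨0, by simp⟩
  | succ k ih =>
    obtain ⟨c, hc⟩ := hres (residue A a)
    have sub_mem : a - φ (C c) ∈ (idealOfVars σ K).map φ := by
      rw [hφ, ← residue_eq_zero_iff, map_sub, ← hc]
      exact sub_eq_zero.mpr (congrArg (residue A) (φ.commutes c).symm)
    obtain ⟨r, hr⟩ : ∃ r, a - φ (C c) - φ r ∈ maximalIdeal A ^ (k + 1) := by
      generalize a - φ (C c) = e at sub_mem
      induction sub_mem using Submodule.closure_induction with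
      | zero => exact ⟨0, by simp⟩
      | add e f _ _ he hf =>
        obtain ⟨⟨r, hr⟩, t, ht⟩ := he, hf
        exact ⟨r + t, by simpa only [map_add, add_sub_add_comm] using add_mem hr ht⟩
      | smul_mem b _ hm =>
        obtain ⟨m, hm, rfl⟩ := hm
        obtain ⟨r, hr⟩ := ih b
        refine ⟨r * m, ?_⟩
        rw [smul_eq_mul, map_mul, ← sub_mul, pow_succ, ← hφ]
        exact Ideal.mul_mem_mul (hφ ▸ hr) (Ideal.mem_map_of_mem φ hm)
    exact ⟨C c + r, by rwa [map_add, ← sub_sub]⟩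

lemma surjective_of_map_idealOfVars (hres : Function.Surjective (algebraMap K (ResidueField A)))
    (hφ : (idealOfVars σ K).map φ = maximalIdeal A) (hA : IsNilpotent (maximalIdeal A)) :
    Function.Surjective φ := by
  intro a
  obtain ⟨k, hk⟩ := hA
  obtain ⟨r, hr⟩ := exists_sub_mem_maximalIdeal_pow hres hφ k a
  rw [hk] at hr
  exact ⟨r, (sub_eq_zero.mp hr).symm⟩

end Surjective

section Presentation

variable {σ K A : Type*} [DecidableEq σ] [Field K] [CommRing A] [IsLocalRing A] [Algebra K A]
  {φ : MvPolynomial σ K →ₐ[K] A} {i : σ}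

lemma exists_isRayPresentation_of_mul_pow_eq_bot {c d : ℕ} (surj : Function.Surjective φ)
    (hφ : (idealOfVars σ K).map φ = maximalIdeal A) (hA : maximalIdeal A ^ (d + 2) = ⊥)
    (hX : φ (X i) ^ (d + 1) ≠ 0) (hc : (axisIdeal K i).map φ * Ideal.span {φ (X i) ^ c} = ⊥)
    (hcd : 2 * c ≤ d + 1) (hd : (axisIdeal K i).map φ * maximalIdeal A ^ d = ⊥) :
    ∃ μ q, IsRayPresentation φ i d μ q := by
  classical
  have pow_eq_zero : φ (X i) ^ (d + 2) = 0 := by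
    rw [← Ideal.mem_bot, ← hA, ← hφ]
    exact Ideal.pow_mem_pow (Ideal.mem_map_of_mem φ (X_mem_idealOfVars i)) _
  have mul_pow (r : MvPolynomial σ K) (hr : r ∈ axisIdeal K i) : φ r * φ (X i) ^ c = 0 := by
    rw [← Ideal.mem_bot, ← hc]
    exact Ideal.mul_mem_mul (Ideal.mem_map_of_mem φ hr) (Ideal.mem_span_singleton_self _)
  have exists_pow_mem : ∃ k, φ (X i) ^ k ∈ (axisIdeal K i).map φ :=
    ⟨d + 2, pow_eq_zero ▸ zero_mem _⟩
  obtain ⟨ν, ⟨q, q_mem, map_q⟩, ν_le⟩ : ∃ ν, (∃ q ∈ axisIdeal K i, φ q = φ (X i) ^ ν) ∧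
      ∀ k, φ (X i) ^ k ∈ (axisIdeal K i).map φ → ν ≤ k :=
    ⟨Nat.find exists_pow_mem, (Ideal.mem_map_iff_of_surjective φ surj).mp
      (Nat.find_spec exists_pow_mem), fun _ => Nat.find_min' exists_pow_mem⟩
  have lt_add : d + 1 < ν + c := by
    by_contra! hle
    exact hX (pow_eq_zero_of_le hle (by rw [pow_add, ← map_q, mul_pow q q_mem]))
  obtain ⟨μ, rfl⟩ : ∃ μ, ν = μ + 1 := ⟨ν - 1, by omega⟩
  refine ⟨μ, q, surj, hφ, hA, q_mem, map_q, fun r hr => ?_, fun r hr => ?_, hd, hX⟩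
  · by_cases h0 : axisProj i r = 0
    · exact h0 ▸ dvd_zero _
    · obtain ⟨k, dvd, mem_of_mem⟩ := exists_aeval_mem_imp_X_pow_mem ⟨d + 2, pow_eq_zero⟩ h0
      refine (pow_dvd_pow _ (ν_le k ?_)).trans dvd
      have := Ideal.mem_map_of_mem φ (sub_axisIncl_mem_axisIdeal (i := i) r)
      rw [map_sub, hr, zero_sub, neg_mem_iff, map_axisIncl] at this
      simpa only [one_mul] using mem_of_mem _ 1 (by rwa [one_mul])
  · rw [← Nat.add_sub_of_le (show c ≤ μ by omega), pow_add, ← mul_assoc, mul_pow r hr, zero_mul]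

end Presentation

variable {K : Type u} [Field K] {A : Type v} [CommRing A] [IsLocalRing A] [Algebra K A]
  [Module.Finite K A]

lemma exists_surjective_axisIdeal_mul_pow_eq_bot
    (hres : Function.Surjective (algebraMap K (ResidueField A)))
    (hA : IsNilpotent (maximalIdeal A)) {n c : ℕ} (hn : hilbertFunction K A 1 = n) {x : A}
    (hx : x ∈ maximalIdeal A) (hx' : x ∉ maximalIdeal A ^ 2)
    (hc : Ideal.span {x ^ (c + 1)} = maximalIdeal A ^ (c + 1)) :
    ∃ (i : Fin n) (φ : MvPolynomial (Fin n) K →ₐ[K] A), Function.Surjective φ ∧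
      (idealOfVars (Fin n) K).map φ = maximalIdeal A ∧ φ (X i) = x ∧
      (axisIdeal K i).map φ * Ideal.span {x ^ c} = ⊥ := by
  obtain ⟨i, g, rfl, hg, g_mul⟩ := exists_generators_mul_pow_eq_zero hn hx hx' hc
  have map_vars : (idealOfVars (Fin n) K).map (aeval g : _ →ₐ[K] A) = maximalIdeal A :=
    (map_aeval_idealOfVars g).trans hg
  refine ⟨i, aeval g, surjective_of_map_idealOfVars hres map_vars hA, map_vars, aeval_X g i, ?_⟩
  rw [axisIdeal_eq_span, Ideal.map_span, Ideal.span_mul_span', Ideal.span_eq_bot]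
  rintro _ ⟨_, ⟨_, ⟨j, hj, rfl⟩, rfl⟩, _, rfl, rfl⟩
  simpa using g_mul j hj

theorem exists_isRayPresentation {n c d : ℕ}
    (hres : Function.Surjective (algebraMap K (ResidueField A)))
    (hd : ((d + 1).factorial : K) ≠ 0) (hn : hilbertFunction K A 1 = n)
    (hs : IsSocleDegree A (d + 1))
    (htail : ∀ j, c < j → j ≤ d + 1 → hilbertFunction K A j = 1)
    (hcd : 2 * c ≤ d + 1) (hexc : d + 1 = 2 → n = 1) :
    ∃ (i : Fin n) (φ : MvPolynomial (Fin n) K →ₐ[K] A) (μ : ℕ) (q : MvPolynomial (Fin n) K),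
      IsRayPresentation φ i d μ q := by
  have : IsNoetherianRing A := IsNoetherianRing.of_finite K A
  have pow_eq_bot := hs.maximalIdeal_pow_succ
  obtain ⟨x, hx, hxs⟩ := hs.exists_pow_ne_zero (by simpa using hd.isUnit.map (algebraMap K A))
  have span_pow {j : ℕ} (hcj : c < j) (hj : j ≤ d + 1) :
      Ideal.span {x ^ j} = maximalIdeal A ^ j :=
    span_singleton_eq_maximalIdeal_pow (htail j hcj hj) (Ideal.pow_mem_pow hx j)
      (pow_notMem_pow_succ pow_eq_bot hx hxs hj)
  obtain ⟨i, φ, surj, map_vars, rfl, axis_mul⟩ :=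
    exists_surjective_axisIdeal_mul_pow_eq_bot hres ⟨_, pow_eq_bot⟩ hn hx
      (by simpa using pow_notMem_pow_succ pow_eq_bot hx hxs (j := 1) (by omega))
      (span_pow c.lt_succ_self (by omega))
  have lt_or_eq_one : c < d ∨ n = 1 := by
    by_contra! h
    obtain rfl | rfl : d = 0 ∨ d = 1 := by omega
    · exact h.2 (hn.symm.trans (htail 1 (by omega) le_rfl))
    · exact h.2 (hexc rfl)
  have axis_mul_pow : (axisIdeal K i).map φ * maximalIdeal A ^ d = ⊥ := by
    obtain hcd | rfl := lt_or_eq_one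
    · rw [← span_pow hcd d.le_succ, ← Nat.add_sub_of_le hcd.le, pow_add,
        ← Ideal.span_singleton_mul_span_singleton, ← mul_assoc, axis_mul, Ideal.bot_mul]
    · have compl_eq_empty : ({i}ᶜ : Set (Fin 1)) = ∅ :=
        Set.eq_empty_of_forall_notMem fun j hj => hj (Subsingleton.elim j i)
      rw [axisIdeal_eq_span, compl_eq_empty, Set.image_empty, Ideal.span_empty, Ideal.map_bot,
        Ideal.bot_mul]
  exact ⟨i, φ, exists_isRayPresentation_of_mul_pow_eq_bot surj map_vars pow_eq_bot hxs axis_mul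
    hcd axis_mul_pow⟩

end Existence

lemma IsRayPresentation.exists_fibre_algEquiv_prod {K : Type u} [Field K] {A : Type v} [CommRing A]
    [IsLocalRing A] [Algebra K A] [Module.Finite K A] {n : ℕ} {φ : MvPolynomial (Fin n) K →ₐ[K] A}
    {i : Fin n} {d μ : ℕ} {q : MvPolynomial (Fin n) K} (h : IsRayPresentation φ i d μ q) {a : K}
    (ha : a ≠ 0) :
    ∃ (B : Type u) (_ : CommRing B) (_ : IsLocalRing B) (_ : Algebra K B) (_ : Module.Finite K B),
      IsSocleDegree B d ∧ (∀ j ≤ d, hilbertFunction K B j = hilbertFunction K A j) ∧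
      ∃ e : Fibre h.rayDecomposition.UpperRayFamily a ≃ₐ[K] K × B, ∀ j,
        (e (fibreCoord h.rayDecomposition a j)).1 = (if j = i then a else 0) ∧
        (e (fibreCoord h.rayDecomposition a j)).2 ∈ maximalIdeal B := by
  obtain ⟨w, hw⟩ := h.exists_mul_sub_eq_one ha
  have := h.isLocalRing_quotient_residualIdeal hw
  have : Module.Finite K (MvPolynomial (Fin n) K ⧸ residualIdeal φ i μ q w) :=
    finite_quotient_of_idealOfVars_pow_le (h.idealOfVars_pow_le_residualIdeal hw)
  obtain ⟨e, he⟩ := h.exists_fibre_upperRayFamily_algEquiv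
    (h.surjective_prod_mk_residualIdeal ha) (h.ker_prod_mk_residualIdeal hw ha)
  refine ⟨_, _, _, _, this, h.isSocleDegree_quotient_residualIdeal hw,
    fun j hj => h.hilbertFunction_quotient_residualIdeal hw hj, e, fun j => ?_⟩
  rw [he]
  constructor
  · obtain rfl | hj := eq_or_ne j i
    · simp [axisProj_X_self]
    · simp [axisProj_X_of_ne hj, hj]
  · rw [← h.maximalIdeal_quotient_residualIdeal hw]
    exact Ideal.mem_map_of_mem _ (X_mem_idealOfVars j)

lemma algebraMap_residueField_surjective (K A : Type*) [Field K] [IsAlgClosed K] [CommRing A]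
    [IsLocalRing A] [Algebra K A] [Module.Finite K A] :
    Function.Surjective (algebraMap K (ResidueField A)) :=
  have : Module.Finite K (ResidueField A) :=
    .of_surjective (IsScalarTower.toAlgHom K A (ResidueField A)).toLinearMap residue_surjective
  IsAlgClosed.algebraMap_bijective_of_isIntegral.surjective

end RayDegeneration

end

theorem mainTheorem3_general {K : Type u} [Field K]
    {A : Type v} [CommRing A] [IsLocalRing A] [Algebra K A] [Module.Finite K A]
    (hres : Function.Surjective (algebraMap K (IsLocalRing.ResidueField A)))
    (n c s : ℕ) (hfac : (s.factorial : K) ≠ 0)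
    (hn : RayDegeneration.hilbertFunction K A 1 = n)
    (hs : RayDegeneration.IsSocleDegree A s)
    (htail : ∀ j, c < j → j ≤ s → RayDegeneration.hilbertFunction K A j = 1)
    (hs_pos : 1 ≤ s) (hsc : 2 * c ≤ s)
    (hexc : s = 2 → n = 1) :
    ∃ (I : Ideal (MvPowerSeries (Fin n) K)) (i : Fin n)
      (D : RayDegeneration.RayDecomposition I i),
      Nonempty (A ≃ₐ[K] (MvPowerSeries (Fin n) K ⧸ I)) ∧
      D.J = I ⊓ RayDegeneration.rayIdeal K i ∧
      1 ≤ D.ν ∧ RayDegeneration.IsRayOrder I i D.ν ∧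
      D.IsUpperRayDegeneration ∧
      Module.Finite (Polynomial K) D.UpperRayFamily ∧
      Nonempty (RayDegeneration.Fibre D.UpperRayFamily (0 : K) ≃ₐ[K] A) ∧
      ∀ a : K, a ≠ 0 →
        ∃ (B : Type u) (_ : CommRing B) (_ : IsLocalRing B) (_ : Algebra K B)
          (_ : Module.Finite K B),
          RayDegeneration.IsSocleDegree B (s - 1) ∧
          (∀ j, j ≤ s - 1 →
            RayDegeneration.hilbertFunction K B j = RayDegeneration.hilbertFunction K A j) ∧
          ∃ e : RayDegeneration.Fibre D.UpperRayFamily a ≃ₐ[K] K × B,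
            ∀ j : Fin n,
              (e (RayDegeneration.fibreCoord D a j)).1 = (if j = i then a else 0) ∧
              (e (RayDegeneration.fibreCoord D a j)).2 ∈ IsLocalRing.maximalIdeal B := by
  obtain ⟨d, rfl⟩ : ∃ d, s = d + 1 := ⟨s - 1, by omega⟩
  obtain ⟨i, φ, μ, q, h⟩ :=
    RayDegeneration.exists_isRayPresentation hres hfac hn hs htail hsc hexc
  obtain ⟨e, -⟩ := h.exists_fibre_upperRayFamily_algEquiv h.surjective h.ker_eq
  exact ⟨h.powerSeriesIdeal, i, h.rayDecomposition, h.nonempty_algEquiv_quotient_powerSeriesIdeal,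
    rfl, Nat.le_add_left 1 μ, h.isRayOrder, h.isUpperRayDegeneration, h.finite_upperRayFamily,
    ⟨e⟩, fun _ ha => h.exists_fibre_algEquiv_prod ha⟩

theorem mainTheorem3 {K : Type u} [Field K] [IsAlgClosed K] [CharZero K]
    {A : Type v} [CommRing A] [IsLocalRing A] [Algebra K A] [Module.Finite K A]
    (n c s : ℕ)
    (hn : RayDegeneration.hilbertFunction K A 1 = n)
    (hs : RayDegeneration.IsSocleDegree A s)
    (htail : ∀ j, c < j → j ≤ s → RayDegeneration.hilbertFunction K A j = 1)
    (hs_pos : 1 ≤ s) (hsc : 2 * c ≤ s)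
    (hexc : s = 2 → n = 1) :
    ∃ (I : Ideal (MvPowerSeries (Fin n) K)) (i : Fin n)
      (D : RayDegeneration.RayDecomposition I i),
      Nonempty (A ≃ₐ[K] (MvPowerSeries (Fin n) K ⧸ I)) ∧
      D.J = I ⊓ RayDegeneration.rayIdeal K i ∧
      1 ≤ D.ν ∧ RayDegeneration.IsRayOrder I i D.ν ∧
      D.IsUpperRayDegeneration ∧
      Module.Finite (Polynomial K) D.UpperRayFamily ∧
      Nonempty (RayDegeneration.Fibre D.UpperRayFamily (0 : K) ≃ₐ[K] A) ∧
      ∀ a : K, a ≠ 0 →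
        ∃ (B : Type u) (_ : CommRing B) (_ : IsLocalRing B) (_ : Algebra K B)
          (_ : Module.Finite K B),
          RayDegeneration.IsSocleDegree B (s - 1) ∧
          (∀ j, j ≤ s - 1 →
            RayDegeneration.hilbertFunction K B j = RayDegeneration.hilbertFunction K A j) ∧
          ∃ e : RayDegeneration.Fibre D.UpperRayFamily a ≃ₐ[K] K × B,
            ∀ j : Fin n,
              (e (RayDegeneration.fibreCoord D a j)).1 = (if j = i then a else 0) ∧
              (e (RayDegeneration.fibreCoord D a j)).2 ∈ IsLocalRing.maximalIdeal B :=
  mainTheorem3_general (RayDegeneration.algebraMap_residueField_surjective K A) n c s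
    (Nat.cast_ne_zero.mpr s.factorial_ne_zero) hn hs htail hs_pos hsc hexc
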